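/- Let $n\ge 1$ and let $A(x,\partial_x)=\sum_{i,j=1}^n a_{ij}(x)\partial_i\partial_j+\sum_{i=1}^n b_i(x)\partial_i+c(x)$ be a second order differential operator on $\mathbb R^n$ whose real coefficients are $C^\infty$ with all derivatives (of every order, including zero) bounded on $\mathbb R^n$, and such that the matrix $(a_{ij}(x))$ is symmetric and positive definite for every $x\in\mathbb R^n$. Let $m=\sqrt{n^2-1}/2$, let $\varphi_0,\varphi_1\in C_0^\infty(\mathbb R^n)$ (complex valued), and let $\psi$ be the solution, of class $C^2$ on $\mathbb R^n\times[0,\infty)$, of the Cauchy problem $$\psi_{tt}+n\psi_t-e^{-2t}A(x,\partial_x)\psi+m^2\psi=0,\qquad \psi(x,0)=\varphi_0(x),\quad \psi_t(x,0)=\varphi_1(x).$$ For $\varphi\in C_0^\infty(\mathbb R^n)$ let $V_\varphi$ and $v_\varphi$ be the $C^\infty(\mathbb R^n\times[0,\infty))$ solutions of $u_{tt}-A(x,\partial_x)u=0$ with, respectively, $V_\varphi(x,0)=0$, $\partial_tV_\varphi(x,0)=\varphi(x)$ and $v_\varphi(x,0)=\varphi(x)$, $\partial_tv_\varphi(x,0)=0$.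 For integers $k\ge 0$ put $$V_\varphi^{(k)}(x)=\frac{(-1)^k}{k!}\,\partial_t^kV_\varphi(x,t)\Big|_{t=1},\qquad v_\varphi^{(k)}(x)=\frac{(-1)^k}{k!}\,\partial_t^kv_\varphi(x,t)\Big|_{t=1},$$ and for every integer $N\ge 1$ let $$\psi^{(N)}_{asympt}(x,z)=z^{\frac{n-1}{2}}\left(\sum_{k=0}^{N-1}v_{\varphi_0}^{(k)}(x)z^k+\frac{n-1}{2}\sum_{k=0}^{N-1}V_{\varphi_0}^{(k)}(x)z^k\right)+z^{\frac{n-1}{2}}\sum_{k=0}^{N-1}V_{\varphi_1}^{(k)}(x)z^k .$$ Then for every integer $N\ge 1$ there are constants $C$ and $T$, depending only on $n$, $A$, $N$, $\varphi_0$ and $\varphi_1$, such that $$\|\psi(\cdot,t)-\psi^{(N)}_{asympt}(\cdot,e^{-t})\|_{L^\infty(\mathbb R^n)}\le C\,e^{-Nt-\frac{n-1}{2}t}\qquad\text{for all } t\ge T .$$ -/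

import Mathlib

open scoped ContDiff

namespace DeSitter

/-- `ℝⁿ` with its Euclidean norm. -/
abbrev Space (n : ℕ) : Type := EuclideanSpace ℝ (Fin n)

/-- The partial derivative `∂f/∂xᵢ`. -/
noncomputable def partialDeriv {n : ℕ} (i : Fin n) (f : Space n → ℂ) (x : Space n) : ℂ :=
  fderiv ℝ f x (EuclideanSpace.single i 1)

/-- The space `𝓑^∞` of real `C^∞` functions on `ℝⁿ` all of whose derivatives, of every order
(including order zero), are uniformly bounded. -/
def IsBInfty {n : ℕ} (f : Space n → ℝ) : Prop :=
  ContDiff ℝ ∞ f ∧ ∀ k : ℕ, ∃ C : ℝ, ∀ x, ‖iteratedFDeriv ℝ k f x‖ ≤ C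

/-- The space `C₀^∞(ℝⁿ)` of smooth compactly supported functions. -/
def IsTestFunction {n : ℕ} (φ : Space n → ℂ) : Prop :=
  ContDiff ℝ ∞ φ ∧ HasCompactSupport φ

/-- A second order negative elliptic differential operator
`A(x,∂ₓ) = ∑ᵢⱼ aᵢⱼ(x) ∂ᵢ∂ⱼ + ∑ᵢ bᵢ(x) ∂ᵢ + c(x)` with real coefficients in `𝓑^∞`, the matrix
`(aᵢⱼ(x))` of the leading coefficients being symmetric and positive definite at each point. -/
structure EllipticOperator (n : ℕ) where
  /-- the coefficients of the second order part -/
  a : Space n → Matrix (Fin n) (Fin n) ℝ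
  /-- the coefficients of the first order part -/
  b : Space n → Fin n → ℝ
  /-- the coefficient of order zero -/
  c : Space n → ℝ
  a_mem : ∀ i j, IsBInfty (fun x => a x i j)
  b_mem : ∀ i, IsBInfty (fun x => b x i)
  c_mem : IsBInfty c
  posDef : ∀ x, (a x).PosDef

/-- The action `f ↦ A(x,∂ₓ) f` of the operator on functions. -/
noncomputable def EllipticOperator.apply {n : ℕ} (A : EllipticOperator n)
    (f : Space n → ℂ) (x : Space n) : ℂ :=
  (∑ i, ∑ j, (A.a x i j : ℂ) * partialDeriv i (partialDeriv j f) x)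
    + (∑ i, (A.b x i : ℂ) * partialDeriv i f x)
    + (A.c x : ℂ) * f x

/-- `u = u(x,t)` is a `C^∞(ℝⁿ × [0,∞))` solution of the Cauchy problem
`u_tt - A(x,∂ₓ) u = 0`, `u(x,0) = g₀(x)`, `u_t(x,0) = g₁(x)`. -/
structure IsWaveSolution {n : ℕ} (A : EllipticOperator n) (g₀ g₁ : Space n → ℂ)
    (u : Space n → ℝ → ℂ) : Prop where
  smooth : ContDiffOn ℝ ∞ (fun p : Space n × ℝ => u p.1 p.2) (Set.univ ×ˢ Set.Ici 0)
  equation : ∀ x, ∀ t : ℝ, 0 < t →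
    iteratedDeriv 2 (fun s => u x s) t - A.apply (fun y => u y t) x = 0
  initial_value : ∀ x, u x 0 = g₀ x
  initial_velocity : ∀ x, derivWithin (fun s => u x s) (Set.Ici 0) 0 = g₁ x

/-- `ψ = ψ(x,t)` is a classical, that is `C²(ℝⁿ × [0,∞))`, solution of the Cauchy problem
`ψ_tt + n ψ_t - e^{-2t} A(x,∂ₓ) ψ + m² ψ = 0`, `ψ(x,0) = φ₀(x)`, `ψ_t(x,0) = φ₁(x)`
for the Klein-Gordon equation in the de Sitter space-time. -/
structure IsKleinGordonSolution {n : ℕ} (A : EllipticOperator n) (m : ℝ)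
    (φ₀ φ₁ : Space n → ℂ) (ψ : Space n → ℝ → ℂ) : Prop where
  contDiffOn : ContDiffOn ℝ 2 (fun p : Space n × ℝ => ψ p.1 p.2) (Set.univ ×ˢ Set.Ici 0)
  equation : ∀ x, ∀ t : ℝ, 0 < t →
    iteratedDeriv 2 (fun s => ψ x s) t + (n : ℂ) * deriv (fun s => ψ x s) t
      - (Real.exp (-2 * t) : ℂ) * A.apply (fun y => ψ y t) x + (m : ℂ) ^ 2 * ψ x t = 0
  initial_value : ∀ x, ψ x 0 = φ₀ x
  initial_velocity : ∀ x, derivWithin (fun s => ψ x s) (Set.Ici 0) 0 = φ₁ x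

/-- The coefficient `u^{(k)}(x) = ((-1)^k / k!) (∂/∂t)^k u(x,t)` at `t = 1`. -/
noncomputable def taylorCoeff {n : ℕ} (u : Space n → ℝ → ℂ) (k : ℕ) (x : Space n) : ℂ :=
  (-1) ^ k / (k.factorial : ℂ) * iteratedDeriv k (fun t => u x t) 1

/-- The function `ψ_asympt^{(N)}(x,z)` built from `v₀ = v_{φ₀}`, `V₀ = V_{φ₀}`, `V₁ = V_{φ₁}`
(the power `z^{(n-1)/2}` is taken with its principal branch). -/
noncomputable def psiAsympt {n : ℕ} (v₀ V₀ V₁ : Space n → ℝ → ℂ) (N : ℕ)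
    (x : Space n) (z : ℂ) : ℂ :=
  z ^ (((n : ℂ) - 1) / 2) *
      ((∑ k ∈ Finset.range N, taylorCoeff v₀ k x * z ^ k)
        + ((n : ℂ) - 1) / 2 * ∑ k ∈ Finset.range N, taylorCoeff V₀ k x * z ^ k)
    + z ^ (((n : ℂ) - 1) / 2) * ∑ k ∈ Finset.range N, taylorCoeff V₁ k x * z ^ k

end DeSitter

namespace DeSitter

open Set Filter Topology MeasureTheory

/-- The integral of a directional derivative of a compactly supported `C¹` function vanishes. -/
theorem integral_fderiv_apply_eq_zero {E : Type*} [NormedAddCommGroup E] [NormedSpace ℝ E]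
    [FiniteDimensional ℝ E] [MeasurableSpace E] [BorelSpace E] (μ : Measure E) [μ.IsAddHaarMeasure]
    {f : E → ℝ} (hf : ContDiff ℝ 1 f) (hs : HasCompactSupport f) (v : E) :
    ∫ x, fderiv ℝ f x v ∂μ = 0 := by
  have hc : Continuous fun x => fderiv ℝ f x v :=
    (hf.continuous_fderiv one_ne_zero).clm_apply continuous_const
  have hsv : HasCompactSupport fun x => fderiv ℝ f x v := hs.fderiv_apply (𝕜 := ℝ) v
  have h := integral_mul_fderiv_eq_neg_fderiv_mul_of_integrable (μ := μ) (v := v)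
    (f := fun _ : E => (1 : ℝ)) (g := f) (by simp)
    (by simpa using hc.integrable_of_hasCompactSupport hsv)
    (by simpa using hf.continuous.integrable_of_hasCompactSupport hs)
    (fun x _ => by fun_prop)
    (fun x _ => (hf.differentiable one_ne_zero) x)
  simpa using h

/-- The slab `E × [0, T)` of space-time. -/
def slab (E : Type*) (T : ℝ) : Set (E × ℝ) := univ ×ˢ Ico 0 T

theorem slab_mem_nhds {E : Type*} [TopologicalSpace E] {T : ℝ} {p : E × ℝ}
    (h0 : 0 < p.2) (hT : p.2 < T) : slab E T ∈ 𝓝 p := by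
  refine mem_of_superset ((isOpen_univ.prod (isOpen_Ioo (a := 0) (b := T))).mem_nhds ?_)
    (prod_mono_right Ioo_subset_Ico_self)
  exact ⟨mem_univ _, h0, hT⟩

theorem slab_zero_mem {E : Type*} {T : ℝ} (hT : 0 < T) (x : E) : (x, (0 : ℝ)) ∈ slab E T :=
  ⟨mem_univ _, le_rfl, hT⟩

/-- Extension by zero to nonpositive times. -/
noncomputable def zeroExt {E : Type*} (f : E × ℝ → ℝ) (p : E × ℝ) : ℝ := if 0 < p.2 then f p else 0

theorem zeroExt_eventuallyEq_of_pos {E : Type*} [TopologicalSpace E] (f : E × ℝ → ℝ) {p : E × ℝ}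
    (hp : 0 < p.2) : zeroExt f =ᶠ[𝓝 p] f := by
  filter_upwards [(isOpen_Ioi.preimage continuous_snd).mem_nhds hp] with q hq
  exact if_pos hq

theorem zeroExt_eventuallyEq_of_neg {E : Type*} [TopologicalSpace E] (f : E × ℝ → ℝ) {p : E × ℝ}
    (hp : p.2 < 0) : zeroExt f =ᶠ[𝓝 p] fun _ => 0 := by
  filter_upwards [(isOpen_Iio.preimage continuous_snd).mem_nhds hp] with q hq
  exact if_neg (not_lt.2 (le_of_lt hq))

theorem Ioo_union_Iic_mem_nhds {E : Type*} [TopologicalSpace E] {T : ℝ} (hT : 0 < T) (x : E) :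
    (univ ×ˢ Ioo 0 T ∪ univ ×ˢ Iic 0 : Set (E × ℝ)) ∈ 𝓝 (x, 0) := by
  filter_upwards [(isOpen_Iio.preimage continuous_snd).mem_nhds
    (show ((x, 0) : E × ℝ) ∈ Prod.snd ⁻¹' Iio T from hT)] with q hq
  rcases le_or_gt q.2 0 with h | h
  · exact Or.inr ⟨mem_univ _, h⟩
  · exact Or.inl ⟨mem_univ _, h, hq⟩

section Flat

variable {E : Type*} [NormedAddCommGroup E] [NormedSpace ℝ E] {T : ℝ} {B : Set E}

theorem uniqueDiffOn_slab (E : Type*) [NormedAddCommGroup E] [NormedSpace ℝ E] (T : ℝ) :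
    UniqueDiffOn ℝ (slab E T) := uniqueDiffOn_univ.prod (uniqueDiffOn_Ico 0 T)

/-- A `C¹` function on the slab that vanishes to first order at the initial points over `B`. -/
structure FlatOn (T : ℝ) (B : Set E) (f : E × ℝ → ℝ) : Prop where
  contDiffOn : ContDiffOn ℝ 1 f (slab E T)
  zero : ∀ x ∈ B, f (x, 0) = 0
  hasFDerivWithinAt : 0 < T → ∀ x ∈ B, HasFDerivWithinAt f (0 : E × ℝ →L[ℝ] ℝ) (slab E T) (x, 0)

theorem FlatOn.of_mul {f g : E × ℝ → ℝ} (hf : ContDiffOn ℝ 1 f (slab E T))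
    (hg : ContDiffOn ℝ 1 g (slab E T)) (hf0 : ∀ x ∈ B, f (x, 0) = 0)
    (hg0 : ∀ x ∈ B, g (x, 0) = 0) : FlatOn T B fun p => f p * g p where
  contDiffOn := hf.mul hg
  zero x hx := by simp [hf0 x hx]
  hasFDerivWithinAt hT x hx := by
    have h1 := (hf.differentiableOn one_ne_zero _ (slab_zero_mem hT x)).hasFDerivWithinAt
    have h2 := (hg.differentiableOn one_ne_zero _ (slab_zero_mem hT x)).hasFDerivWithinAt
    simpa [hf0 x hx, hg0 x hx] using h1.fun_mul h2

theorem FlatOn.mul_left {f g : E × ℝ → ℝ} (hf : ContDiffOn ℝ 1 f (slab E T))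
    (hg : FlatOn T B g) : FlatOn T B fun p => f p * g p where
  contDiffOn := hf.mul hg.contDiffOn
  zero x hx := by simp [hg.zero x hx]
  hasFDerivWithinAt hT x hx := by
    have h1 := (hf.differentiableOn one_ne_zero _ (slab_zero_mem hT x)).hasFDerivWithinAt
    simpa [hg.zero x hx] using h1.fun_mul (hg.hasFDerivWithinAt hT x hx)

theorem FlatOn.add {f g : E × ℝ → ℝ} (hf : FlatOn T B f)
    (hg : FlatOn T B g) : FlatOn T B fun p => f p + g p where
  contDiffOn := hf.contDiffOn.add hg.contDiffOn
  zero x hx := by simp [hg.zero x hx, hf.zero x hx]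
  hasFDerivWithinAt hT x hx := by
    simpa using (hf.hasFDerivWithinAt hT x hx).fun_add (hg.hasFDerivWithinAt hT x hx)

theorem FlatOn.sum {ι : Type*} {s : Finset ι} {f : ι → E × ℝ → ℝ}
    (hf : ∀ i ∈ s, FlatOn T B (f i)) : FlatOn T B fun p => ∑ i ∈ s, f i p where
  contDiffOn := ContDiffOn.sum fun i hi => (hf i hi).contDiffOn
  zero x hx := Finset.sum_eq_zero fun i hi => (hf i hi).zero x hx
  hasFDerivWithinAt hT x hx := by
    simpa using HasFDerivWithinAt.fun_sum fun i hi => (hf i hi).hasFDerivWithinAt hT x hx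

/-- The derivative of the extension by zero of a flat function. -/
theorem FlatOn.hasFDerivAt_zeroExt {f : E × ℝ → ℝ} (hf : FlatOn T B f) {p : E × ℝ}
    (hB : p.1 ∈ B) (hT : p.2 < T) : HasFDerivAt (zeroExt f)
      (if 0 < p.2 then fderivWithin ℝ f (slab E T) p else 0) p := by
  rcases lt_trichotomy p.2 0 with h | h | h
  · rw [if_neg (not_lt.2 h.le)]
    exact (hasFDerivAt_const (0 : ℝ) p).congr_of_eventuallyEq (zeroExt_eventuallyEq_of_neg f h)
  · obtain ⟨x, t⟩ := p
    simp only at h hB hT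
    subst h
    rw [if_neg (lt_irrefl _)]
    have hl : HasFDerivWithinAt (zeroExt f) (0 : E × ℝ →L[ℝ] ℝ) (univ ×ˢ Ioo 0 T) (x, 0) :=
      ((hf.hasFDerivWithinAt hT x hB).mono (prod_mono_right Ioo_subset_Ico_self)).congr
        (fun q hq => if_pos hq.2.1) (by simp [zeroExt, hf.zero x hB])
    have hr : HasFDerivWithinAt (zeroExt f) (0 : E × ℝ →L[ℝ] ℝ) (univ ×ˢ Iic 0) (x, 0) :=
      (hasFDerivWithinAt_const (0 : ℝ) _ _).congr
        (fun q hq => if_neg (not_lt.2 hq.2)) (by simp [zeroExt])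
    exact (hl.union hr).hasFDerivAt (Ioo_union_Iic_mem_nhds hT x)
  · rw [if_pos h, fderivWithin_of_mem_nhds (slab_mem_nhds h hT)]
    have := (hf.contDiffOn.differentiableOn one_ne_zero).differentiableAt (slab_mem_nhds h hT)
    exact this.hasFDerivAt.congr_of_eventuallyEq (zeroExt_eventuallyEq_of_pos f h)

theorem FlatOn.continuousAt_fderiv_zeroExt {f : E × ℝ → ℝ} (hf : FlatOn T B f) {p : E × ℝ}
    (hB : p.1 ∈ B) (hT : p.2 < T) : ContinuousAt
      (fun p => if 0 < p.2 then fderivWithin ℝ f (slab E T) p else 0) p := by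
  have hc : ContinuousOn (fderivWithin ℝ f (slab E T)) (slab E T) :=
    hf.contDiffOn.continuousOn_fderivWithin (uniqueDiffOn_slab E T) le_rfl
  rcases lt_trichotomy p.2 0 with h | h | h
  · refine (continuousAt_const (y := (0 : E × ℝ →L[ℝ] ℝ))).congr ?_
    filter_upwards [(isOpen_Iio.preimage continuous_snd).mem_nhds h] with q hq
    exact (if_neg (not_lt.2 (le_of_lt hq))).symm
  · obtain ⟨x, t⟩ := p
    simp only at h hB hT
    subst h
    have h0 : fderivWithin ℝ f (slab E T) (x, 0) = 0 :=
      (hf.hasFDerivWithinAt hT x hB).fderivWithin (uniqueDiffOn_slab E T _ (slab_zero_mem hT x))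
    have hl : ContinuousWithinAt (fun p : E × ℝ => if 0 < p.2 then fderivWithin ℝ f (slab E T) p
        else 0) (univ ×ˢ Ioo 0 T) (x, 0) :=
      ((hc _ (slab_zero_mem hT x)).mono (prod_mono_right Ioo_subset_Ico_self)).congr
        (fun q hq => if_pos hq.2.1) (by simp [h0])
    have hr : ContinuousWithinAt (fun p : E × ℝ => if 0 < p.2 then fderivWithin ℝ f (slab E T) p
        else 0) (univ ×ˢ Iic 0) (x, 0) :=
      (continuousWithinAt_const (b := (0 : E × ℝ →L[ℝ] ℝ))).congr
        (fun q hq => if_neg (not_lt.2 hq.2)) (by simp)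
    exact (hl.union hr).continuousAt (Ioo_union_Iic_mem_nhds hT x)
  · refine (hc.continuousAt (slab_mem_nhds h hT)).congr ?_
    filter_upwards [(isOpen_Ioi.preimage continuous_snd).mem_nhds h] with q hq
    exact (if_pos hq).symm

/-- If a flat function vanishes at positive times off a compact subset of `B × [0, T)`, then its
extension by zero is `C¹` on the whole space-time. -/
theorem FlatOn.contDiff_zeroExt {f : E × ℝ → ℝ} (hf : FlatOn T B f) (hB : IsOpen B)
    {K : Set (E × ℝ)} (hK : IsClosed K) (hKB : K ⊆ B ×ˢ Iio T)
    (hfK : ∀ p, 0 < p.2 → p ∉ K → f p = 0) : ContDiff ℝ 1 (zeroExt f) := by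
  rw [contDiff_iff_contDiffAt]
  intro p
  by_cases hp : p ∈ K
  · have hΩ : B ×ˢ Iio T ∈ 𝓝 p := (hB.prod isOpen_Iio).mem_nhds (hKB hp)
    rw [contDiffAt_one_iff]
    refine ⟨_, _, hΩ, fun q hq => ?_, fun q hq => hf.hasFDerivAt_zeroExt hq.1 hq.2⟩
    exact (hf.continuousAt_fderiv_zeroExt hq.1 hq.2).continuousWithinAt
  · refine (contDiffAt_const (c := (0 : ℝ))).congr_of_eventuallyEq ?_
    filter_upwards [hK.isOpen_compl.mem_nhds hp] with q hq
    unfold zeroExt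
    split_ifs with h
    · exact hfK q h hq
    · rfl

theorem hasCompactSupport_zeroExt {E : Type*} [NormedAddCommGroup E] {f : E × ℝ → ℝ}
    {K : Set (E × ℝ)} (hK : IsCompact K)
    (hfK : ∀ p, 0 < p.2 → p ∉ K → f p = 0) : HasCompactSupport (zeroExt f) := by
  refine HasCompactSupport.intro hK fun q hq => ?_
  unfold zeroExt
  split_ifs with h
  · exact hfK q h hq
  · rfl

/-- The derivative of the extension by zero vanishes at nonpositive times. -/
theorem FlatOn.fderiv_zeroExt_of_nonpos {f : E × ℝ → ℝ} (hf : FlatOn T B f) (hT : 0 < T)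
    {K : Set (E × ℝ)} (hK : IsClosed K) (hKB : K ⊆ B ×ˢ Iio T)
    (hfK : ∀ p, 0 < p.2 → p ∉ K → f p = 0) {p : E × ℝ} (hp : p.2 ≤ 0) :
    fderiv ℝ (zeroExt f) p = 0 := by
  by_cases hpK : p ∈ K
  · simpa [not_lt.2 hp] using (hf.hasFDerivAt_zeroExt (hKB hpK).1 (hp.trans_lt hT)).fderiv
  · have h : zeroExt f =ᶠ[𝓝 p] fun _ => 0 := by
      filter_upwards [hK.isOpen_compl.mem_nhds hpK] with q hq
      unfold zeroExt
      split_ifs with h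
      · exact hfK q h hq
      · rfl
    rw [h.fderiv_eq]; simp

end Flat

variable {n : ℕ}

theorem IsBInfty.contDiff_one {f : Space n → ℝ} (hf : IsBInfty f) : ContDiff ℝ 1 f :=
  hf.1.of_le (mod_cast le_top)

theorem IsBInfty.exists_bound {f : Space n → ℝ} (hf : IsBInfty f) : ∃ C, ∀ x, |f x| ≤ C := by
  obtain ⟨C, hC⟩ := hf.2 0
  exact ⟨C, fun x => by simpa using hC x⟩

/-- The quadratic form of the principal part. -/
def EllipticOperator.quad (A : EllipticOperator n) (x : Space n) (ξ η : Fin n → ℝ) : ℝ :=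
  ∑ i, ∑ j, A.a x i j * (ξ i * η j)

theorem EllipticOperator.symm (A : EllipticOperator n) (x : Space n) (i j : Fin n) :
    A.a x i j = A.a x j i := by
  simpa using ((A.posDef x).isHermitian.apply i j).symm

theorem EllipticOperator.quad_pos (A : EllipticOperator n) (x : Space n) {ξ : Fin n → ℝ}
    (hξ : ξ ≠ 0) : 0 < A.quad x ξ ξ := by
  have h := (A.posDef x).dotProduct_mulVec_pos hξ
  refine h.trans_eq ?_
  simp only [dotProduct, Matrix.mulVec, Finset.mul_sum, EllipticOperator.quad]
  refine Finset.sum_congr rfl fun i _ => Finset.sum_congr rfl fun j _ => ?_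
  simp; ring

theorem EllipticOperator.quad_nonneg (A : EllipticOperator n) (x : Space n) (ξ : Fin n → ℝ) :
    0 ≤ A.quad x ξ ξ := by
  rcases eq_or_ne ξ 0 with rfl | h
  · simp [EllipticOperator.quad]
  · exact (A.quad_pos x h).le

theorem EllipticOperator.quad_symm (A : EllipticOperator n) (x : Space n) (ξ η : Fin n → ℝ) :
    A.quad x ξ η = A.quad x η ξ := by
  unfold EllipticOperator.quad
  rw [Finset.sum_comm]
  refine Finset.sum_congr rfl fun i _ => Finset.sum_congr rfl fun j _ => ?_
  rw [A.symm x j i]; ring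

/-- Boundedness of the propagation speed. -/
theorem EllipticOperator.exists_speed (A : EllipticOperator n) :
    ∃ M : ℝ, 0 < M ∧ ∀ x ξ, A.quad x ξ ξ ≤ M ^ 2 * ∑ i, ξ i ^ 2 := by
  choose C hC using fun i j => (A.a_mem i j).exists_bound
  have hC0 : ∀ i j, 0 ≤ C i j := fun i j => (abs_nonneg _).trans (hC i j 0)
  have hS : 0 ≤ ∑ i, ∑ j, C i j := Finset.sum_nonneg fun i _ => Finset.sum_nonneg fun j _ => hC0 i j
  refine ⟨1 + ∑ i, ∑ j, C i j, by linarith, fun x ξ => ?_⟩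
  have hξ : 0 ≤ ∑ i, ξ i ^ 2 := Finset.sum_nonneg fun i _ => sq_nonneg _
  have h1 : A.quad x ξ ξ ≤ (∑ i, ∑ j, C i j) * ∑ i, ξ i ^ 2 := by
    simp only [EllipticOperator.quad, Finset.sum_mul]
    refine Finset.sum_le_sum fun i _ => Finset.sum_le_sum fun j _ => ?_
    have hi := Finset.single_le_sum (fun k _ => sq_nonneg (ξ k)) (Finset.mem_univ i)
    have hj := Finset.single_le_sum (fun k _ => sq_nonneg (ξ k)) (Finset.mem_univ j)
    have hij : |ξ i * ξ j| ≤ ∑ k, ξ k ^ 2 :=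
      abs_le.2 ⟨by nlinarith [sq_nonneg (ξ i + ξ j)], by nlinarith [sq_nonneg (ξ i - ξ j)]⟩
    calc A.a x i j * (ξ i * ξ j) ≤ |A.a x i j * (ξ i * ξ j)| := le_abs_self _
      _ = |A.a x i j| * |ξ i * ξ j| := abs_mul _ _
      _ ≤ C i j * ∑ k, ξ k ^ 2 := mul_le_mul (hC i j x) hij (abs_nonneg _) (hC0 i j)
  refine h1.trans (mul_le_mul_of_nonneg_right ?_ hξ)
  nlinarith

/-- Uniform ellipticity on compact sets. -/
theorem EllipticOperator.exists_ellipticity (A : EllipticOperator n) {K : Set (Space n)}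
    (hK : IsCompact K) : ∃ c : ℝ, 0 < c ∧ ∀ x ∈ K, ∀ ξ, c * ∑ i, ξ i ^ 2 ≤ A.quad x ξ ξ := by
  have hcont : Continuous fun q : Space n × Space n => A.quad q.1 q.2 q.2 := by
    unfold EllipticOperator.quad
    refine continuous_finsetSum _ fun i _ => continuous_finsetSum _ fun j _ => ?_
    have := (A.a_mem i j).1.continuous
    fun_prop
  have hS : IsCompact (K ×ˢ Metric.sphere (0 : Space n) 1) := hK.prod (isCompact_sphere 0 1)
  rcases (K ×ˢ Metric.sphere (0 : Space n) 1).eq_empty_or_nonempty with he | hne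
  · refine ⟨1, one_pos, fun x hx ξ => ?_⟩
    by_cases hξ : ξ = 0
    · simp [hξ, EllipticOperator.quad]
    · exfalso
      have hξ' : (WithLp.toLp 2 ξ : Space n) ≠ 0 := by simpa using hξ
      have : (x, (‖(WithLp.toLp 2 ξ : Space n)‖⁻¹ • WithLp.toLp 2 ξ : Space n)) ∈
          K ×ˢ Metric.sphere (0 : Space n) 1 := by
        refine ⟨hx, ?_⟩
        simp [norm_smul, hξ]
      simp [he] at this
  · obtain ⟨q, hq, hmin⟩ := hS.exists_isMinOn hne hcont.continuousOn
    have hq0 : (q.2 : Fin n → ℝ) ≠ 0 := by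
      intro h
      have h1 : ‖q.2‖ = 1 := by simpa using hq.2
      have h2 : q.2 = 0 := by ext i; simpa using congrFun h i
      simp [h2] at h1
    refine ⟨A.quad q.1 q.2 q.2, A.quad_pos _ hq0, fun x hx ξ => ?_⟩
    by_cases hξ : ξ = 0
    · simp [hξ, EllipticOperator.quad]
    set e : Space n := WithLp.toLp 2 ξ with he
    have hr : 0 < ‖e‖ := norm_pos_iff.2 (by simpa [he] using hξ)
    have h1 := isMinOn_iff.1 hmin (x, ‖e‖⁻¹ • e) ⟨hx, by simp [norm_smul, hr.ne']⟩
    have h2 : A.quad x (‖e‖⁻¹ • e : Space n) (‖e‖⁻¹ • e : Space n) = ‖e‖⁻¹ ^ 2 * A.quad x ξ ξ := by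
      simp only [EllipticOperator.quad, Finset.mul_sum]
      refine Finset.sum_congr rfl fun i _ => Finset.sum_congr rfl fun j _ => ?_
      simp [he]; ring
    have h3 : ∑ i, ξ i ^ 2 = ‖e‖ ^ 2 := by
      rw [EuclideanSpace.norm_sq_eq]; simp [he]
    simp only at h1
    rw [h2] at h1
    rw [h3]
    calc A.quad q.1 q.2 q.2 * ‖e‖ ^ 2 ≤ ‖e‖⁻¹ ^ 2 * A.quad x ξ ξ * ‖e‖ ^ 2 := by gcongr
      _ = A.quad x ξ ξ := by field_simp

/-- The energy flux is controlled by the energy density. -/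
theorem EllipticOperator.flux_le (A : EllipticOperator n) {M : ℝ} (hM : 0 < M)
    (hA : ∀ x ξ, A.quad x ξ ξ ≤ M ^ 2 * ∑ i, ξ i ^ 2) (x : Space n) (s : ℝ) (ξ η : Fin n → ℝ)
    (hη : ∑ i, η i ^ 2 ≤ 1) : 2 * s * A.quad x η ξ ≤ M * (s ^ 2 + A.quad x ξ ξ) := by
  have h0 := A.quad_nonneg x (fun i => M * ξ i - s * η i)
  have h1 : A.quad x (fun i => M * ξ i - s * η i) (fun i => M * ξ i - s * η i) =
      M ^ 2 * A.quad x ξ ξ - M * s * A.quad x ξ η - M * s * A.quad x η ξ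
        + s ^ 2 * A.quad x η η := by
    simp only [EllipticOperator.quad, Finset.mul_sum, ← Finset.sum_sub_distrib,
      ← Finset.sum_add_distrib]
    refine Finset.sum_congr rfl fun i _ => Finset.sum_congr rfl fun j _ => ?_
    ring
  have h2 : s ^ 2 * A.quad x η η ≤ s ^ 2 * M ^ 2 :=
    mul_le_mul_of_nonneg_left ((hA x η).trans (by nlinarith [sq_nonneg M])) (sq_nonneg s)
  rw [h1, A.quad_symm x ξ η] at h0
  nlinarith

/-- The smoothed distance `√(1 + |x - x₀|²)`. -/
noncomputable def smoothDist (x₀ x : Space n) : ℝ := Real.sqrt (1 + ‖x - x₀‖ ^ 2)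

theorem contDiff_smoothDist (x₀ : Space n) : ContDiff ℝ 1 (smoothDist x₀) := by
  unfold smoothDist
  refine ContDiff.sqrt (contDiff_const.add ((contDiff_id.sub contDiff_const).norm_sq ℝ)) ?_
  intro x
  positivity

theorem norm_sub_lt_smoothDist (x₀ x : Space n) : ‖x - x₀‖ < smoothDist x₀ x :=
  Real.lt_sqrt_of_sq_lt (by linarith)

theorem one_le_smoothDist (x₀ x : Space n) : 1 ≤ smoothDist x₀ x :=
  Real.one_le_sqrt.2 (by nlinarith [sq_nonneg ‖x - x₀‖])

theorem smoothDist_self (x₀ : Space n) : smoothDist x₀ x₀ = 1 := by simp [smoothDist]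

theorem sum_sq_fderiv_smoothDist_le (x₀ x : Space n) :
    ∑ i, (fderiv ℝ (smoothDist x₀) x (EuclideanSpace.single i 1)) ^ 2 ≤ 1 := by
  have h1 : HasFDerivAt (fun y : Space n => 1 + ‖y - x₀‖ ^ 2)
      (2 • (innerSL ℝ (x - x₀)).comp (ContinuousLinearMap.id ℝ (Space n))) x :=
    (((hasFDerivAt_id x).sub_const x₀).norm_sq).const_add 1
  have h2 : HasFDerivAt (smoothDist x₀) _ x := h1.sqrt (by positivity)
  have h3 : ∀ i, fderiv ℝ (smoothDist x₀) x (EuclideanSpace.single i 1) =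
      (x - x₀) i / smoothDist x₀ x := by
    intro i
    rw [h2.fderiv]
    simp [smoothDist, EuclideanSpace.inner_single_right]
    field_simp
  have h4 : 0 < smoothDist x₀ x := one_pos.trans_le (one_le_smoothDist x₀ x)
  simp only [h3, div_pow, ← Finset.sum_div]
  rw [div_le_one (by positivity)]
  have h5 : ∑ i, (x - x₀) i ^ 2 = ‖x - x₀‖ ^ 2 := by
    rw [EuclideanSpace.norm_sq_eq]; simp
  rw [h5]
  exact pow_le_pow_left₀ (norm_nonneg _) (norm_sub_lt_smoothDist x₀ x).le 2

/-- The weight `e^{-lt} h(R - Mt - √(1 + |x - x₀|²))`, supported in a backward cone. -/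
noncomputable def coneWeight (x₀ : Space n) (l M R : ℝ) (p : Space n × ℝ) : ℝ :=
  Real.exp (-l * p.2) * Real.smoothTransition (R - M * p.2 - smoothDist x₀ p.1)

theorem contDiff_coneWeight (x₀ : Space n) (l M R : ℝ) : ContDiff ℝ 1 (coneWeight x₀ l M R) := by
  unfold coneWeight
  have h1 : ContDiff ℝ 1 fun p : Space n × ℝ => smoothDist x₀ p.1 :=
    (contDiff_smoothDist x₀).comp contDiff_fst
  have h2 : ContDiff ℝ 1 Real.smoothTransition := Real.smoothTransition.contDiff (n := 1)
  exact (by fun_prop : ContDiff ℝ 1 fun p : Space n × ℝ => Real.exp (-l * p.2)).mul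
    (h2.comp ((contDiff_const.sub (contDiff_const.mul contDiff_snd)).sub h1))

theorem coneWeight_nonneg (x₀ : Space n) (l M R : ℝ) (p : Space n × ℝ) :
    0 ≤ coneWeight x₀ l M R p :=
  mul_nonneg (Real.exp_pos _).le (Real.smoothTransition.nonneg _)

theorem coneWeight_fderiv (x₀ : Space n) (l M R : ℝ) (p : Space n × ℝ) :
    ∃ θ : ℝ, 0 ≤ θ ∧ ∃ η : Fin n → ℝ, ∑ i, η i ^ 2 ≤ 1 ∧
      fderiv ℝ (coneWeight x₀ l M R) p (0, 1) = -l * coneWeight x₀ l M R p - M * θ ∧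
      ∀ i, fderiv ℝ (coneWeight x₀ l M R) p (EuclideanSpace.single i 1, 0) = -θ * η i := by
  set s := R - M * p.2 - smoothDist x₀ p.1 with hs
  have hh : HasDerivAt Real.smoothTransition (deriv Real.smoothTransition s) s :=
    ((Real.smoothTransition.contDiff (n := 1)).differentiable (by simp) s).hasDerivAt
  have hD := ((contDiff_smoothDist x₀).differentiable one_ne_zero p.1).hasFDerivAt
  have hD' : HasFDerivAt (fun q : Space n × ℝ => smoothDist x₀ q.1) _ p :=
    hD.comp p hasFDerivAt_fst
  have hm : HasFDerivAt (fun q : Space n × ℝ => R - M * q.2 - smoothDist x₀ q.1) _ p :=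
    (((hasFDerivAt_snd (𝕜 := ℝ) (p := p)).const_mul M).const_sub R).sub hD'
  have hW1 := hh.comp_hasFDerivAt p hm
  have he := ((hasFDerivAt_snd (𝕜 := ℝ) (p := p)).const_mul (-l)).exp
  have hW : HasFDerivAt (coneWeight x₀ l M R) _ p := he.fun_mul hW1
  refine ⟨Real.exp (-l * p.2) * deriv Real.smoothTransition s,
    mul_nonneg (Real.exp_pos _).le Real.smoothTransition.monotone.deriv_nonneg,
    fun i => fderiv ℝ (smoothDist x₀) p.1 (EuclideanSpace.single i 1),
    sum_sq_fderiv_smoothDist_le x₀ p.1, ?_, fun i => ?_⟩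
  · rw [hW.fderiv]
    simp [coneWeight]
    ring
  · rw [hW.fderiv]
    simp
    ring

/-- The energy density. -/
def energyDensity (A : EllipticOperator n) (u v : Space n × ℝ → ℝ) (w : Fin n → Space n × ℝ → ℝ)
    (p : Space n × ℝ) : ℝ :=
  v p * v p + (∑ i, ∑ j, A.a p.1 i j * (w i p * w j p)) + u p * u p

/-- The components of the energy flux. -/
def energyFlux (A : EllipticOperator n) (v : Space n × ℝ → ℝ) (w : Fin n → Space n × ℝ → ℝ)
    (i : Fin n) (p : Space n × ℝ) : ℝ :=
  ∑ j, 2 * A.a p.1 i j * (v p * w j p)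

/-- The first order system satisfied by `u`, `v = u_t` and `wᵢ = ∂ᵢu` when `u_tt = A u`. -/
structure IsFirstOrderSolution (A : EllipticOperator n) (T : ℝ) (u v : Space n × ℝ → ℝ)
    (w : Fin n → Space n × ℝ → ℝ) : Prop where
  u_contDiffOn : ContDiffOn ℝ 1 u (slab (Space n) T)
  v_contDiffOn : ContDiffOn ℝ 1 v (slab (Space n) T)
  w_contDiffOn : ∀ i, ContDiffOn ℝ 1 (w i) (slab (Space n) T)
  u_time : ∀ p : Space n × ℝ, 0 < p.2 → p.2 < T → fderiv ℝ u p (0, 1) = v p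
  w_time : ∀ i, ∀ p : Space n × ℝ, 0 < p.2 → p.2 < T →
    fderiv ℝ (w i) p (0, 1) = fderiv ℝ v p (EuclideanSpace.single i 1, 0)
  v_time : ∀ p : Space n × ℝ, 0 < p.2 → p.2 < T → fderiv ℝ v p (0, 1) =
    (∑ i, ∑ j, A.a p.1 i j * fderiv ℝ (w j) p (EuclideanSpace.single i 1, 0))
      + (∑ i, A.b p.1 i * w i p) + A.c p.1 * u p

section Energy

variable {A : EllipticOperator n} {T : ℝ} {u v : Space n × ℝ → ℝ} {w : Fin n → Space n × ℝ → ℝ}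

theorem hasFDerivAt_coeff (A : EllipticOperator n) (i j : Fin n) (p : Space n × ℝ) :
    HasFDerivAt (fun q : Space n × ℝ => A.a q.1 i j)
      ((fderiv ℝ (fun x => A.a x i j) p.1).comp (ContinuousLinearMap.fst ℝ (Space n) ℝ)) p :=
  (((A.a_mem i j).contDiff_one.differentiable one_ne_zero) p.1).hasFDerivAt.comp p hasFDerivAt_fst

theorem fderiv_weighted_density {W : Space n × ℝ → ℝ} {p : Space n × ℝ}
    (hW : DifferentiableAt ℝ W p) (hu : DifferentiableAt ℝ u p) (hv : DifferentiableAt ℝ v p)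
    (hw : ∀ i, DifferentiableAt ℝ (w i) p) :
    fderiv ℝ (fun q => W q * energyDensity A u v w q) p (0, 1) =
      fderiv ℝ W p (0, 1) * energyDensity A u v w p + W p * (2 * v p * fderiv ℝ v p (0, 1)
        + 2 * A.quad p.1 (fun i => fderiv ℝ (w i) p (0, 1)) (fun i => w i p)
        + 2 * u p * fderiv ℝ u p (0, 1)) := by
  have h1 : HasFDerivAt (fun q => ∑ i, ∑ j, A.a q.1 i j * (w i q * w j q)) _ p :=
    HasFDerivAt.fun_sum (u := Finset.univ) fun i _ => HasFDerivAt.fun_sum (u := Finset.univ)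
      fun j _ => (hasFDerivAt_coeff A i j p).fun_mul
        ((hw i).hasFDerivAt.fun_mul (hw j).hasFDerivAt)
  have h2 : HasFDerivAt (fun q => W q * energyDensity A u v w q) _ p :=
    hW.hasFDerivAt.fun_mul (((hv.hasFDerivAt.fun_mul hv.hasFDerivAt).fun_add h1).fun_add
      (hu.hasFDerivAt.fun_mul hu.hasFDerivAt))
  have h3 : ∑ i, ∑ j, A.a p.1 i j * (w i p * fderiv ℝ (w j) p (0, 1) +
      w j p * fderiv ℝ (w i) p (0, 1)) =
      2 * A.quad p.1 (fun i => fderiv ℝ (w i) p (0, 1)) (fun i => w i p) := by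
    rw [two_mul]
    nth_rewrite 1 [A.quad_symm]
    simp only [EllipticOperator.quad, ← Finset.sum_add_distrib]
    refine Finset.sum_congr rfl fun i _ => Finset.sum_congr rfl fun j _ => ?_
    ring
  rw [h2.fderiv, ← h3]
  simp [energyDensity]
  ring_nf

theorem fderiv_weighted_flux {W : Space n × ℝ → ℝ} {p : Space n × ℝ}
    (hW : DifferentiableAt ℝ W p) (hv : DifferentiableAt ℝ v p)
    (hw : ∀ i, DifferentiableAt ℝ (w i) p) (i : Fin n) :
    fderiv ℝ (fun q => W q * energyFlux A v w i q) p (EuclideanSpace.single i 1, 0) =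
      fderiv ℝ W p (EuclideanSpace.single i 1, 0) * energyFlux A v w i p
      + W p * ∑ j, 2 * (
        fderiv ℝ (fun x => A.a x i j) p.1 (EuclideanSpace.single i 1) * (v p * w j p)
        + A.a p.1 i j * (fderiv ℝ v p (EuclideanSpace.single i 1, 0) * w j p)
        + v p * (A.a p.1 i j * fderiv ℝ (w j) p (EuclideanSpace.single i 1, 0))) := by
  have h1 : HasFDerivAt (fun q => ∑ j, 2 * A.a q.1 i j * (v q * w j q)) _ p :=
    HasFDerivAt.fun_sum (u := Finset.univ) fun j _ =>
      ((hasFDerivAt_coeff A i j p).const_mul 2).fun_mul (hv.hasFDerivAt.fun_mul (hw j).hasFDerivAt)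
  have h2 : HasFDerivAt (fun q => W q * energyFlux A v w i q) _ p := hW.hasFDerivAt.fun_mul h1
  rw [h2.fderiv]
  simp only [add_apply, smul_apply, smul_eq_mul,
    sum_apply, ContinuousLinearMap.comp_apply, ContinuousLinearMap.coe_fst']
  rw [add_comm]
  congr 1
  · ring
  · congr 1
    refine Finset.sum_congr rfl fun j _ => ?_
    ring

end Energy

/-- The coefficients of the first order terms left after integrating by parts. -/
noncomputable def EllipticOperator.drift (A : EllipticOperator n) (x : Space n) (j : Fin n) : ℝ :=
  A.b x j - ∑ i, fderiv ℝ (fun y => A.a y i j) x (EuclideanSpace.single i 1)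

theorem EllipticOperator.continuous_drift (A : EllipticOperator n) (j : Fin n) :
    Continuous fun x => A.drift x j := by
  unfold EllipticOperator.drift
  refine (A.b_mem j).1.continuous.sub (continuous_finsetSum _ fun i _ => ?_)
  exact ((A.a_mem i j).contDiff_one.continuous_fderiv one_ne_zero).clm_apply continuous_const

/-- On a compact set the lower order terms are controlled by the energy density. -/
theorem EllipticOperator.exists_lower_order_bound (A : EllipticOperator n) {K : Set (Space n)}
    (hK : IsCompact K) : ∃ C : ℝ, ∀ x ∈ K, ∀ (s r : ℝ) (ξ : Fin n → ℝ),
      2 * s * (∑ j, A.drift x j * ξ j + (A.c x + 1) * r) ≤ C * (s ^ 2 + A.quad x ξ ξ + r ^ 2) := by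
  obtain ⟨c, hc, hell⟩ := A.exists_ellipticity hK
  have hβ : ∀ j, ∃ D, ∀ x ∈ K, |A.drift x j| ≤ D := fun j => by
    simpa using hK.exists_bound_of_continuousOn (A.continuous_drift j).continuousOn
  choose D hD using hβ
  obtain ⟨G, hG⟩ := hK.exists_bound_of_continuousOn
    (A.c_mem.1.continuous.add continuous_const : Continuous fun x => A.c x + 1).continuousOn
  simp only [Real.norm_eq_abs] at hG
  refine ⟨(∑ j, |D j| + |G|) * (1 + c⁻¹), fun x hx s r ξ => ?_⟩
  set Q := A.quad x ξ ξ
  have hQ : 0 ≤ Q := A.quad_nonneg x ξ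
  have hell' : ∑ i, ξ i ^ 2 ≤ c⁻¹ * Q := by
    rw [inv_mul_eq_div, le_div_iff₀ hc, mul_comm]; exact hell x hx ξ
  have key : ∀ α β y : ℝ, |α| ≤ β → 2 * s * (α * y) ≤ |β| * (s ^ 2 + y ^ 2) := by
    intro α β y h
    have h1 : |α| ≤ |β| := h.trans (le_abs_self β)
    have h2 : 2 * |s| * |y| ≤ s ^ 2 + y ^ 2 := by
      nlinarith [sq_nonneg (|s| - |y|), sq_abs s, sq_abs y]
    calc 2 * s * (α * y) ≤ |2 * s * (α * y)| := le_abs_self _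
      _ = |α| * (2 * |s| * |y|) := by rw [abs_mul, abs_mul, abs_mul, abs_two]; ring
      _ ≤ |β| * (s ^ 2 + y ^ 2) := mul_le_mul h1 h2 (by positivity) (abs_nonneg _)
  have hci : 0 < c⁻¹ := inv_pos.2 hc
  have hE : ∀ y : ℝ, y ^ 2 ≤ c⁻¹ * Q → s ^ 2 + y ^ 2 ≤ (1 + c⁻¹) * (s ^ 2 + Q + r ^ 2) := by
    intro y hy
    nlinarith [mul_nonneg hci.le (sq_nonneg s), mul_nonneg hci.le (sq_nonneg r), sq_nonneg r]
  have h1 : ∀ j, 2 * s * (A.drift x j * ξ j) ≤ |D j| * ((1 + c⁻¹) * (s ^ 2 + Q + r ^ 2)) := by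
    intro j
    refine (key _ _ _ (hD j x hx)).trans (mul_le_mul_of_nonneg_left (hE _ ?_) (abs_nonneg _))
    exact (Finset.single_le_sum (fun k _ => sq_nonneg (ξ k)) (Finset.mem_univ j)).trans hell'
  have h2 : 2 * s * ((A.c x + 1) * r) ≤ |G| * ((1 + c⁻¹) * (s ^ 2 + Q + r ^ 2)) := by
    refine (key _ _ _ (hG x hx)).trans (mul_le_mul_of_nonneg_left ?_ (abs_nonneg _))
    nlinarith [mul_nonneg hci.le (sq_nonneg s), mul_nonneg hci.le (sq_nonneg r),
      mul_nonneg hci.le hQ]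
  calc 2 * s * (∑ j, A.drift x j * ξ j + (A.c x + 1) * r)
      = ∑ j, 2 * s * (A.drift x j * ξ j) + 2 * s * ((A.c x + 1) * r) := by
        rw [mul_add, Finset.mul_sum]
    _ ≤ ∑ j, |D j| * ((1 + c⁻¹) * (s ^ 2 + Q + r ^ 2))
        + |G| * ((1 + c⁻¹) * (s ^ 2 + Q + r ^ 2)) :=
        add_le_add (Finset.sum_le_sum fun j _ => h1 j) h2
    _ = _ := by rw [← Finset.sum_mul]; ring

section Energy

variable {A : EllipticOperator n} {T : ℝ} {u v : Space n × ℝ → ℝ} {w : Fin n → Space n × ℝ → ℝ}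

theorem energyDensity_eq (p : Space n × ℝ) : energyDensity A u v w p =
    v p ^ 2 + A.quad p.1 (fun i => w i p) (fun i => w i p) + u p ^ 2 := by
  simp only [energyDensity, EllipticOperator.quad]; ring

theorem sq_le_energyDensity (p : Space n × ℝ) : u p ^ 2 ≤ energyDensity A u v w p := by
  rw [energyDensity_eq]
  nlinarith [A.quad_nonneg p.1 (fun i => w i p), sq_nonneg (v p)]

theorem energyDensity_nonneg (p : Space n × ℝ) : 0 ≤ energyDensity A u v w p :=
  (sq_nonneg _).trans (sq_le_energyDensity p)

/-- The differential energy inequality with the cone weight. -/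
theorem IsFirstOrderSolution.divergence_le (hS : IsFirstOrderSolution A T u v w) {M : ℝ}
    (hM : 0 < M) (hA : ∀ x ξ, A.quad x ξ ξ ≤ M ^ 2 * ∑ i, ξ i ^ 2) (x₀ : Space n) (C R : ℝ)
    {p : Space n × ℝ} (hp0 : 0 < p.2) (hpT : p.2 < T)
    (hC : ∀ (s r : ℝ) (ξ : Fin n → ℝ), 2 * s * (∑ j, A.drift p.1 j * ξ j + (A.c p.1 + 1) * r) ≤
      C * (s ^ 2 + A.quad p.1 ξ ξ + r ^ 2)) :
    fderiv ℝ (fun q => coneWeight x₀ (C + 1) M R q * energyDensity A u v w q) p (0, 1)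
      - ∑ i, fderiv ℝ (fun q => coneWeight x₀ (C + 1) M R q * energyFlux A v w i q) p
          (EuclideanSpace.single i 1, 0)
      ≤ -(coneWeight x₀ (C + 1) M R p * energyDensity A u v w p) := by
  have hn := slab_mem_nhds hp0 hpT
  have hu := (hS.u_contDiffOn.differentiableOn one_ne_zero).differentiableAt hn
  have hv := (hS.v_contDiffOn.differentiableOn one_ne_zero).differentiableAt hn
  have hw := fun i => ((hS.w_contDiffOn i).differentiableOn one_ne_zero).differentiableAt hn
  have hW := (contDiff_coneWeight x₀ (C + 1) M R).differentiable one_ne_zero p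
  rw [fderiv_weighted_density hW hu hv hw]
  simp only [fderiv_weighted_flux hW hv hw]
  obtain ⟨θ, hθ, η, hη, ht, hx⟩ := coneWeight_fderiv x₀ (C + 1) M R p
  have hWn := coneWeight_nonneg x₀ (C + 1) M R p
  simp only [ht, hx, hS.u_time p hp0 hpT, hS.w_time _ p hp0 hpT, hS.v_time p hp0 hpT]
  set W := coneWeight x₀ (C + 1) M R p
  set e := energyDensity A u v w p with he
  set ξ : Fin n → ℝ := fun i => w i p with hξ
  set dv : Fin n → ℝ := fun i => fderiv ℝ v p (EuclideanSpace.single i 1, 0) with hdv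
  have hflux : ∑ i, -θ * η i * energyFlux A v w i p = -θ * (2 * v p * A.quad p.1 η ξ) := by
    simp only [energyFlux, EllipticOperator.quad, Finset.mul_sum, hξ]
    refine Finset.sum_congr rfl fun i _ => Finset.sum_congr rfl fun j _ => ?_
    ring
  have hdiv : ∑ i, W * ∑ j, 2 * (
        fderiv ℝ (fun x => A.a x i j) p.1 (EuclideanSpace.single i 1) * (v p * w j p)
        + A.a p.1 i j * (fderiv ℝ v p (EuclideanSpace.single i 1, 0) * w j p)
        + v p * (A.a p.1 i j * fderiv ℝ (w j) p (EuclideanSpace.single i 1, 0)))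
      = W * (2 * v p * (∑ j, (∑ i, fderiv ℝ (fun x => A.a x i j) p.1
            (EuclideanSpace.single i 1)) * ξ j) + 2 * A.quad p.1 dv ξ
        + 2 * v p * ∑ i, ∑ j,
            A.a p.1 i j * fderiv ℝ (w j) p (EuclideanSpace.single i 1, 0)) := by
    rw [← Finset.mul_sum]
    congr 1
    have h1 : ∑ j, (∑ i, fderiv ℝ (fun x => A.a x i j) p.1 (EuclideanSpace.single i 1)) * ξ j
        = ∑ i, ∑ j, fderiv ℝ (fun x => A.a x i j) p.1 (EuclideanSpace.single i 1) * ξ j := by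
      rw [Finset.sum_comm]
      simp only [Finset.sum_mul]
    rw [h1]
    simp only [EllipticOperator.quad, Finset.mul_sum, ← Finset.sum_add_distrib, hξ, hdv]
    refine Finset.sum_congr rfl fun i _ => Finset.sum_congr rfl fun j _ => ?_
    ring
  rw [Finset.sum_add_distrib, hflux, hdiv]
  have hlow := hC (v p) (u p) ξ
  have hdrift : ∑ j, A.drift p.1 j * ξ j = ∑ j, A.b p.1 j * ξ j - ∑ j, (∑ i, fderiv ℝ
      (fun x => A.a x i j) p.1 (EuclideanSpace.single i 1)) * ξ j := by
    simp only [EllipticOperator.drift, sub_mul, Finset.sum_sub_distrib]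
  have hee : e = v p ^ 2 + A.quad p.1 ξ ξ + u p ^ 2 := energyDensity_eq p
  rw [hdrift, ← hee] at hlow
  have hfl := A.flux_le hM hA p.1 (v p) ξ η hη
  have hfl' : 2 * v p * A.quad p.1 η ξ ≤ M * e :=
    hfl.trans (mul_le_mul_of_nonneg_left (by rw [hee]; nlinarith [sq_nonneg (u p)]) hM.le)
  have h1 := mul_le_mul_of_nonneg_left hfl' hθ
  have h2 := mul_le_mul_of_nonneg_left hlow hWn
  have h3 : ∑ i, A.b p.1 i * w i p = ∑ j, A.b p.1 j * ξ j := rfl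
  rw [h3]
  nlinarith

theorem coneWeight_eq_zero {x₀ : Space n} {l M t₁ : ℝ} (hM : 0 < M) {p : Space n × ℝ}
    (hp : 0 < p.2) (hpK : p ∉ Metric.closedBall x₀ (1 + M * t₁) ×ˢ Icc 0 t₁) :
    coneWeight x₀ l M (1 + M * t₁) p = 0 := by
  have h1 := one_le_smoothDist x₀ p.1
  have h2 := norm_sub_lt_smoothDist x₀ p.1
  have h3 : 1 + M * t₁ - M * p.2 - smoothDist x₀ p.1 ≤ 0 := by
    by_cases hd : p.1 ∈ Metric.closedBall x₀ (1 + M * t₁)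
    · have ht : t₁ < p.2 := by
        by_contra h
        exact hpK ⟨hd, hp.le, not_lt.1 h⟩
      nlinarith
    · rw [Metric.mem_closedBall, dist_eq_norm, not_le] at hd
      nlinarith
  simp [coneWeight, Real.smoothTransition.zero_of_nonpos h3]

/-- Local uniqueness in backward cones for the first order system. -/
theorem IsFirstOrderSolution.eq_zero (hS : IsFirstOrderSolution A T u v w) {M : ℝ}
    (hM : 0 < M) (hA : ∀ x ξ, A.quad x ξ ξ ≤ M ^ 2 * ∑ i, ξ i ^ 2) (x₀ : Space n)
    (hu0 : ∀ x ∈ Metric.ball x₀ (1 + M * T), u (x, 0) = 0)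
    (hv0 : ∀ x ∈ Metric.ball x₀ (1 + M * T), v (x, 0) = 0)
    (hw0 : ∀ i, ∀ x ∈ Metric.ball x₀ (1 + M * T), w i (x, 0) = 0)
    {t : ℝ} (ht : 0 < t) (htT : t < T) : u (x₀, t) = 0 := by
  obtain ⟨t₁, htt₁, ht₁T⟩ := exists_between htT
  set R := 1 + M * t₁ with hR
  set B := Metric.ball x₀ (1 + M * T) with hB
  set K : Set (Space n × ℝ) := Metric.closedBall x₀ R ×ˢ Icc 0 t₁ with hK
  have hKc : IsCompact K := (isCompact_closedBall x₀ R).prod isCompact_Icc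
  have hKB : K ⊆ B ×ˢ Iio T := prod_mono
    (Metric.closedBall_subset_ball (by rw [hR]; gcongr)) fun s hs => hs.2.trans_lt ht₁T
  obtain ⟨C, hC⟩ := A.exists_lower_order_bound (isCompact_closedBall x₀ R)
  set W := coneWeight x₀ (C + 1) M R with hW
  have hWs : ContDiffOn ℝ 1 W (slab (Space n) T) := (contDiff_coneWeight x₀ (C + 1) M R).contDiffOn
  have hWK : ∀ p : Space n × ℝ, 0 < p.2 → p ∉ K → W p = 0 := fun p hp hpK =>
    coneWeight_eq_zero hM hp hpK
  have ha : ∀ i j, ContDiffOn ℝ 1 (fun p : Space n × ℝ => A.a p.1 i j) (slab (Space n) T) :=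
    fun i j => ((A.a_mem i j).contDiff_one.comp contDiff_fst).contDiffOn
  set f : Space n × ℝ → ℝ := fun p => W p * energyDensity A u v w p with hf
  set g : Fin n → Space n × ℝ → ℝ := fun i p => W p * energyFlux A v w i p with hg
  have hfF : FlatOn T B f := by
    refine FlatOn.mul_left hWs (((FlatOn.of_mul hS.v_contDiffOn hS.v_contDiffOn hv0 hv0).add
      ?_).add (FlatOn.of_mul hS.u_contDiffOn hS.u_contDiffOn hu0 hu0))
    exact FlatOn.sum fun i _ => FlatOn.sum fun j _ => FlatOn.mul_left (ha i j)
      (FlatOn.of_mul (hS.w_contDiffOn i) (hS.w_contDiffOn j) (hw0 i) (hw0 j))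
  have hgF : ∀ i, FlatOn T B (g i) := fun i =>
    FlatOn.mul_left hWs (FlatOn.sum fun j _ => FlatOn.mul_left (contDiffOn_const.mul (ha i j))
      (FlatOn.of_mul hS.v_contDiffOn (hS.w_contDiffOn j) hv0 (hw0 j)))
  have hfK : ∀ p : Space n × ℝ, 0 < p.2 → p ∉ K → f p = 0 := fun p hp hpK => by
    simp [hf, hWK p hp hpK]
  have hgK : ∀ i, ∀ p : Space n × ℝ, 0 < p.2 → p ∉ K → g i p = 0 := fun i p hp hpK => by
    simp [hg, hWK p hp hpK]
  have hT : 0 < T := ht.trans htT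
  have hfC := hfF.contDiff_zeroExt Metric.isOpen_ball hKc.isClosed hKB hfK
  have hgC := fun i => (hgF i).contDiff_zeroExt Metric.isOpen_ball hKc.isClosed hKB (hgK i)
  have hfS := hasCompactSupport_zeroExt hKc hfK
  have hgS := fun i => hasCompactSupport_zeroExt hKc (hgK i)
  have hnonneg : ∀ p, 0 ≤ zeroExt f p := fun p => by
    unfold zeroExt
    split_ifs
    · exact mul_nonneg (coneWeight_nonneg _ _ _ _ _) (energyDensity_nonneg p)
    · exact le_rfl
  have hle : ∀ p, fderiv ℝ (zeroExt f) p (0, 1)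
      - ∑ i, fderiv ℝ (zeroExt (g i)) p (EuclideanSpace.single i 1, 0) ≤ -zeroExt f p := by
    intro p
    rcases le_or_gt p.2 0 with hp | hp
    · rw [hfF.fderiv_zeroExt_of_nonpos hT hKc.isClosed hKB hfK hp]
      simp only [(hgF _).fderiv_zeroExt_of_nonpos hT hKc.isClosed hKB (hgK _) hp]
      simp [zeroExt, not_lt.2 hp]
    · by_cases hpK : p ∈ K
      · rw [(zeroExt_eventuallyEq_of_pos f hp).fderiv_eq,
          (zeroExt_eventuallyEq_of_pos f hp).eq_of_nhds]
        have hgd : ∀ i, fderiv ℝ (zeroExt (g i)) p = fderiv ℝ (g i) p := fun i =>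
          (zeroExt_eventuallyEq_of_pos (g i) hp).fderiv_eq
        simp only [hgd]
        exact hS.divergence_le hM hA x₀ C R hp (hKB hpK).2 (hC p.1 hpK.1)
      · have hz : ∀ k : Space n × ℝ → ℝ, (∀ p : Space n × ℝ, 0 < p.2 → p ∉ K → k p = 0) →
            zeroExt k =ᶠ[𝓝 p] fun _ => 0 := by
          intro k hk
          filter_upwards [hKc.isClosed.isOpen_compl.mem_nhds hpK] with q hq
          unfold zeroExt
          split_ifs with h
          · exact hk q h hq
          · rfl
        rw [(hz f hfK).fderiv_eq, (hz f hfK).eq_of_nhds]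
        have hgd : ∀ i, fderiv ℝ (zeroExt (g i)) p = fderiv ℝ (fun _ => (0 : ℝ)) p := fun i =>
          (hz (g i) (hgK i)).fderiv_eq
        simp only [hgd]
        simp
  have hint : ∀ k : Space n × ℝ → ℝ, ContDiff ℝ 1 k → HasCompactSupport k → ∀ d,
      Integrable fun p => fderiv ℝ k p d := fun k hk hks d =>
    ((hk.continuous_fderiv one_ne_zero).clm_apply continuous_const).integrable_of_hasCompactSupport
      (hks.fderiv_apply (𝕜 := ℝ) d)
  have hsum : Integrable fun p : Space n × ℝ =>
      ∑ i, fderiv ℝ (zeroExt (g i)) p (EuclideanSpace.single i 1, 0) :=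
    integrable_finsetSum _ fun i _ => hint _ (hgC i) (hgS i) _
  have hμ : (volume : Measure (Space n × ℝ)).IsAddHaarMeasure :=
    inferInstanceAs ((volume : Measure (Space n)).prod (volume : Measure ℝ)).IsAddHaarMeasure
  have hI : ∫ p, (fderiv ℝ (zeroExt f) p (0, 1)
      - ∑ i, fderiv ℝ (zeroExt (g i)) p (EuclideanSpace.single i 1, 0)) = 0 := by
    rw [integral_sub (hint _ hfC hfS _) hsum,
      integral_finsetSum _ fun i _ => hint _ (hgC i) (hgS i) _,
      integral_fderiv_apply_eq_zero _ hfC hfS]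
    simp [fun i => integral_fderiv_apply_eq_zero volume (hgC i) (hgS i)]
  have hJ : ∫ p, zeroExt f p ≤ 0 := by
    have := integral_mono ((hint _ hfC hfS _).sub hsum)
      (hfC.continuous.integrable_of_hasCompactSupport hfS).neg hle
    simp only [Pi.sub_apply, Pi.neg_apply] at this
    rw [hI, integral_neg] at this
    linarith
  have hfz : zeroExt f (x₀, t) = 0 := by
    by_contra hne
    exact absurd (hfC.continuous.integral_pos_of_hasCompactSupport_nonneg_nonzero hfS hnonneg hne)
      (not_lt.2 hJ)
  have hWpos : 0 < W (x₀, t) := by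
    refine mul_pos (Real.exp_pos _) (Real.smoothTransition.pos_of_pos ?_)
    simp only [smoothDist_self, hR]
    nlinarith
  have h1 : W (x₀, t) * energyDensity A u v w (x₀, t) = 0 := by
    have : zeroExt f (x₀, t) = f (x₀, t) := if_pos ht
    rw [← hfz, this]
  have h2 : energyDensity A u v w (x₀, t) = 0 := (mul_eq_zero.1 h1).resolve_left hWpos.ne'
  have h3 : u (x₀, t) ^ 2 ≤ 0 := h2 ▸ sq_le_energyDensity (x₀, t)
  exact pow_eq_zero_iff two_ne_zero |>.1 (le_antisymm h3 (sq_nonneg _))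

end Energy

/-- A `C²` solution of `u_tt = A u` on the slab `ℝⁿ × [0, T)` with initial data `g₀`, `g₁`, the
equation being written with Fréchet derivatives in space-time. -/
structure IsWaveOn (A : EllipticOperator n) (T : ℝ) (g₀ g₁ : Space n → ℂ)
    (U : Space n × ℝ → ℂ) : Prop where
  contDiffOn : ContDiffOn ℝ 2 U (slab (Space n) T)
  equation : ∀ p : Space n × ℝ, 0 < p.2 → p.2 < T →
    fderiv ℝ (fderiv ℝ U) p (0, 1) (0, 1) =
      (∑ i, ∑ j, (A.a p.1 i j : ℂ) * fderiv ℝ (fderiv ℝ U) p (EuclideanSpace.single i 1, 0)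
        (EuclideanSpace.single j 1, 0))
      + (∑ i, (A.b p.1 i : ℂ) * fderiv ℝ U p (EuclideanSpace.single i 1, 0)) + (A.c p.1 : ℂ) * U p
  value : ∀ x, U (x, 0) = g₀ x
  velocity : ∀ x, HasDerivWithinAt (fun s => U (x, s)) (g₁ x) (Ici 0) 0

section Slices

variable {G : Space n × ℝ → ℂ} {x : Space n} {t : ℝ}

theorem fderiv_slice_space (hG : DifferentiableAt ℝ G (x, t)) (v : Space n) :
    fderiv ℝ (fun y => G (y, t)) x v = fderiv ℝ G (x, t) (v, 0) := by
  have h : HasFDerivAt (fun y => G (y, t)) _ x :=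
    hG.hasFDerivAt.comp x (hasFDerivAt_prodMk_left x t)
  rw [h.fderiv]; simp

theorem hasDerivAt_slice_time (hG : DifferentiableAt ℝ G (x, t)) :
    HasDerivAt (fun s => G (x, s)) (fderiv ℝ G (x, t) (0, 1)) t :=
  hG.hasFDerivAt.comp_hasDerivAt t ((hasDerivAt_const t x).prodMk (hasDerivAt_id t))

theorem fderiv_fderiv_apply (hG : ContDiffAt ℝ 2 G (x, t)) (d e : Space n × ℝ) :
    fderiv ℝ (fun q => fderiv ℝ G q e) (x, t) d = fderiv ℝ (fderiv ℝ G) (x, t) d e := by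
  have h : DifferentiableAt ℝ (fderiv ℝ G) (x, t) :=
    (hG.fderiv_right (m := 1) (by norm_num)).differentiableAt one_ne_zero
  rw [(h.hasFDerivAt.clm_apply (hasFDerivAt_const e _)).fderiv]; simp

theorem eventually_differentiableAt (hG : ContDiffAt ℝ 2 G (x, t)) :
    ∀ᶠ q in 𝓝 (x, t), DifferentiableAt ℝ G q :=
  (hG.eventually (by simp)).mono fun _ hq => hq.differentiableAt two_ne_zero

theorem differentiableAt_fderiv_apply (hG : ContDiffAt ℝ 2 G (x, t)) (e : Space n × ℝ) :
    DifferentiableAt ℝ (fun q => fderiv ℝ G q e) (x, t) :=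
  ((hG.fderiv_right (m := 1) (by norm_num)).differentiableAt one_ne_zero).clm_apply
    (differentiableAt_const e)

theorem partialDeriv_slice (hG : DifferentiableAt ℝ G (x, t)) (i : Fin n) :
    partialDeriv i (fun y => G (y, t)) x = fderiv ℝ G (x, t) (EuclideanSpace.single i 1, 0) :=
  fderiv_slice_space hG _

theorem partialDeriv_partialDeriv_slice (hG : ContDiffAt ℝ 2 G (x, t)) (i j : Fin n) :
    partialDeriv i (partialDeriv j (fun y => G (y, t))) x =
      fderiv ℝ (fderiv ℝ G) (x, t) (EuclideanSpace.single i 1, 0)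
        (EuclideanSpace.single j 1, 0) := by
  have h1 : partialDeriv j (fun y => G (y, t)) =ᶠ[𝓝 x]
      fun y => fderiv ℝ G (y, t) (EuclideanSpace.single j 1, 0) := by
    have hc : ContinuousAt (fun y : Space n => (y, t)) x := by fun_prop
    filter_upwards [hc.eventually (eventually_differentiableAt hG)] with y hy
    exact partialDeriv_slice hy j
  unfold partialDeriv at h1 ⊢
  rw [h1.fderiv_eq, fderiv_slice_space (G := fun q => fderiv ℝ G q (EuclideanSpace.single j 1, 0))
    (differentiableAt_fderiv_apply hG _), fderiv_fderiv_apply hG]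

theorem iteratedDeriv_two_slice (hG : ContDiffAt ℝ 2 G (x, t)) :
    iteratedDeriv 2 (fun s => G (x, s)) t = fderiv ℝ (fderiv ℝ G) (x, t) (0, 1) (0, 1) := by
  have h1 : deriv (fun s => G (x, s)) =ᶠ[𝓝 t] fun s => fderiv ℝ G (x, s) (0, 1) := by
    have hc : ContinuousAt (fun s : ℝ => (x, s)) t := by fun_prop
    filter_upwards [hc.eventually (eventually_differentiableAt hG)] with s hs
    exact (hasDerivAt_slice_time hs).deriv
  rw [iteratedDeriv_succ, iteratedDeriv_one, h1.deriv_eq,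
    (hasDerivAt_slice_time (G := fun q => fderiv ℝ G q (0, 1))
      (differentiableAt_fderiv_apply hG _)).deriv, fderiv_fderiv_apply hG]

theorem apply_slice (A : EllipticOperator n) (hG : ContDiffAt ℝ 2 G (x, t)) :
    A.apply (fun y => G (y, t)) x =
      (∑ i, ∑ j, (A.a x i j : ℂ) * fderiv ℝ (fderiv ℝ G) (x, t) (EuclideanSpace.single i 1, 0)
        (EuclideanSpace.single j 1, 0))
      + (∑ i, (A.b x i : ℂ) * fderiv ℝ G (x, t) (EuclideanSpace.single i 1, 0))
      + (A.c x : ℂ) * G (x, t) := by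
  simp only [EllipticOperator.apply, partialDeriv_partialDeriv_slice hG,
    partialDeriv_slice (hG.differentiableAt two_ne_zero)]

end Slices

section Wave

variable {A : EllipticOperator n} {T : ℝ} {g₀ g₁ h₀ h₁ : Space n → ℂ} {U V : Space n × ℝ → ℂ}

theorem IsWaveOn.contDiffAt (hU : IsWaveOn A T g₀ g₁ U) {p : Space n × ℝ} (h0 : 0 < p.2)
    (hT : p.2 < T) : ContDiffAt ℝ 2 U p := hU.contDiffOn.contDiffAt (slab_mem_nhds h0 hT)

theorem IsWaveOn.of_slices (hU : ContDiffOn ℝ 2 U (slab (Space n) T))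
    (heq : ∀ x, ∀ t : ℝ, 0 < t → t < T →
      iteratedDeriv 2 (fun s => U (x, s)) t = A.apply (fun y => U (y, t)) x)
    (h0 : ∀ x, U (x, 0) = g₀ x)
    (h1 : ∀ x, HasDerivWithinAt (fun s => U (x, s)) (g₁ x) (Ici 0) 0) : IsWaveOn A T g₀ g₁ U where
  contDiffOn := hU
  value := h0
  velocity := h1
  equation := by
    rintro ⟨x, t⟩ ht htT
    have hG : ContDiffAt ℝ 2 U (x, t) := hU.contDiffAt (slab_mem_nhds ht htT)
    rw [← iteratedDeriv_two_slice hG, heq x t ht htT, apply_slice A hG]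

theorem IsWaveSolution.isWaveOn {u : Space n → ℝ → ℂ} (hu : IsWaveSolution A g₀ g₁ u) (T : ℝ) :
    IsWaveOn A T g₀ g₁ fun p => u p.1 p.2 := by
  refine IsWaveOn.of_slices (contDiffOn_infty.1 (hu.smooth.mono
    (prod_mono_right Ico_subset_Ici_self)) 2)
    (fun x t ht _ => sub_eq_zero.1 (hu.equation x t ht)) hu.initial_value fun x => ?_
  rw [← hu.initial_velocity x]
  refine DifferentiableWithinAt.hasDerivWithinAt ?_
  have h := (hu.smooth.differentiableOn (by simp)) (x, 0) ⟨mem_univ _, self_mem_Ici⟩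
  exact h.comp (0 : ℝ) (by fun_prop : DifferentiableWithinAt ℝ (fun s : ℝ => (x, s)) (Ici 0) 0)
    fun s hs => ⟨mem_univ _, hs⟩

theorem IsWaveOn.add (hU : IsWaveOn A T g₀ g₁ U) (hV : IsWaveOn A T h₀ h₁ V) :
    IsWaveOn A T (g₀ + h₀) (g₁ + h₁) (U + V) where
  contDiffOn := hU.contDiffOn.add hV.contDiffOn
  value x := by simp [hU.value, hV.value]
  velocity x := (hU.velocity x).add (hV.velocity x)
  equation p h0 hT := by
    have hU2 := hU.contDiffAt h0 hT
    have hV2 := hV.contDiffAt h0 hT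
    have hev : fderiv ℝ (U + V) =ᶠ[𝓝 p] fderiv ℝ U + fderiv ℝ V := by
      filter_upwards [eventually_differentiableAt hU2, eventually_differentiableAt hV2] with q h1 h2
      exact fderiv_add h1 h2
    have hU1 := (hU2.fderiv_right (m := 1) (by norm_num)).differentiableAt one_ne_zero
    have hV1 := (hV2.fderiv_right (m := 1) (by norm_num)).differentiableAt one_ne_zero
    rw [hev.fderiv_eq, fderiv_add hU1 hV1, hev.eq_of_nhds]
    simp only [add_apply, Pi.add_apply, hU.equation p h0 hT, hV.equation p h0 hT, mul_add,
      Finset.sum_add_distrib]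
    ring

theorem IsWaveOn.const_smul (hU : IsWaveOn A T g₀ g₁ U) (c : ℂ) :
    IsWaveOn A T (c • g₀) (c • g₁) (c • U) where
  contDiffOn := hU.contDiffOn.const_smul c
  value x := by simp [hU.value]
  velocity x := (hU.velocity x).const_smul c
  equation p h0 hT := by
    have hU2 := hU.contDiffAt h0 hT
    have hev : fderiv ℝ (c • U) =ᶠ[𝓝 p] c • fderiv ℝ U := by
      filter_upwards [eventually_differentiableAt hU2] with q h1
      exact fderiv_const_smul h1 c
    have hU1 := (hU2.fderiv_right (m := 1) (by norm_num)).differentiableAt one_ne_zero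
    rw [hev.fderiv_eq, fderiv_const_smul hU1 c, hev.eq_of_nhds]
    simp only [smul_apply, Pi.smul_apply, hU.equation p h0 hT, smul_eq_mul, mul_add,
      Finset.mul_sum, mul_left_comm c]

theorem IsWaveOn.isFirstOrderSolution (hU : IsWaveOn A T g₀ g₁ U) (L : ℂ →L[ℝ] ℝ) :
    IsFirstOrderSolution A T (fun p => L (U p))
      (fun p => L (fderivWithin ℝ U (slab (Space n) T) p (0, 1)))
      (fun i p => L (fderivWithin ℝ U (slab (Space n) T) p (EuclideanSpace.single i 1, 0))) := by
  have hD : ContDiffOn ℝ 1 (fderivWithin ℝ U (slab (Space n) T)) (slab (Space n) T) :=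
    hU.contDiffOn.fderivWithin (uniqueDiffOn_slab _ T) (by norm_num)
  have hLc : ∀ (F : Space n × ℝ → ℂ) (p : Space n × ℝ), DifferentiableAt ℝ F p → ∀ d,
      fderiv ℝ (fun q => L (F q)) p d = L (fderiv ℝ F p d) := fun F p hF d =>
    DFunLike.congr_fun (L.hasFDerivAt.comp p hF.hasFDerivAt).fderiv d
  have hloc : ∀ p : Space n × ℝ, 0 < p.2 → p.2 < T → ∀ d e : Space n × ℝ,
      fderiv ℝ (fun q => L (fderivWithin ℝ U (slab (Space n) T) q e)) p d =
        L (fderiv ℝ (fderiv ℝ U) p d e) := by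
    intro p h0 hT d e
    have hev : (fun q => L (fderivWithin ℝ U (slab (Space n) T) q e)) =ᶠ[𝓝 p]
        fun q => L (fderiv ℝ U q e) := by
      filter_upwards [(isOpen_Ioo.preimage continuous_snd).mem_nhds
        (show p ∈ Prod.snd ⁻¹' Ioo 0 T from ⟨h0, hT⟩)] with q hq
      rw [fderivWithin_of_mem_nhds (slab_mem_nhds hq.1 hq.2)]
    have hG := hU.contDiffAt h0 hT
    rw [hev.fderiv_eq, hLc _ p (differentiableAt_fderiv_apply hG e)]
    exact congrArg L (fderiv_fderiv_apply hG d e)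
  have hLr : ∀ (r : ℝ) (z : ℂ), L ((r : ℂ) * z) = r * L z := fun r z => by
    rw [← Complex.real_smul, map_smul, smul_eq_mul]
  refine ⟨L.contDiff.comp_contDiffOn (hU.contDiffOn.of_le (by norm_num)),
    L.contDiff.comp_contDiffOn (hD.clm_apply contDiffOn_const),
    fun i => L.contDiff.comp_contDiffOn (hD.clm_apply contDiffOn_const), ?_, ?_, ?_⟩
  · intro p h0 hT
    rw [fderivWithin_of_mem_nhds (slab_mem_nhds h0 hT)]
    exact hLc _ p ((hU.contDiffAt h0 hT).differentiableAt two_ne_zero) _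
  · intro i p h0 hT
    rw [hloc p h0 hT, hloc p h0 hT]
    congr 1
    exact ((hU.contDiffAt h0 hT).isSymmSndFDerivAt (by simp)).eq _ _
  · intro p h0 hT
    simp only [hloc p h0 hT, hU.equation p h0 hT, map_add, map_sum, hLr,
      fderivWithin_of_mem_nhds (slab_mem_nhds h0 hT)]

/-- Finite speed of propagation. -/
theorem IsWaveOn.eq_zero (hU : IsWaveOn A T g₀ g₁ U) {M : ℝ} (hM : 0 < M)
    (hA : ∀ x ξ, A.quad x ξ ξ ≤ M ^ 2 * ∑ i, ξ i ^ 2) {x₀ : Space n}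
    (h₀ : ∀ x ∈ Metric.ball x₀ (1 + M * T), g₀ x = 0)
    (h₁ : ∀ x ∈ Metric.ball x₀ (1 + M * T), g₁ x = 0)
    {t : ℝ} (ht : 0 ≤ t) (htT : t < T) : U (x₀, t) = 0 := by
  have hT : 0 < T := ht.trans_lt htT
  rcases ht.eq_or_lt with rfl | ht
  · rw [hU.value, h₀ _ (Metric.mem_ball_self (by positivity))]
  have hD : ∀ x, HasFDerivWithinAt U (fderivWithin ℝ U (slab (Space n) T) (x, 0))
      (slab (Space n) T) (x, 0) := fun x =>
    (hU.contDiffOn.differentiableOn two_ne_zero _ (slab_zero_mem hT x)).hasFDerivWithinAt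
  have hvel : ∀ x ∈ Metric.ball x₀ (1 + M * T),
      fderivWithin ℝ U (slab (Space n) T) (x, 0) (0, 1) = 0 := by
    intro x hx
    have h1 : HasDerivWithinAt (fun s => U (x, s))
        (fderivWithin ℝ U (slab (Space n) T) (x, 0) (0, 1)) (Ico 0 T) 0 :=
      (hD x).comp_hasDerivWithinAt (0 : ℝ)
        ((hasDerivWithinAt_const 0 _ x).prodMk (hasDerivWithinAt_id 0 _))
        fun s hs => ⟨mem_univ _, hs⟩
    have h2 := (hU.velocity x).mono (Ico_subset_Ici_self : Ico 0 T ⊆ Ici 0)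
    rw [← h₁ x hx]
    exact (uniqueDiffOn_Ico 0 T 0 ⟨le_rfl, hT⟩).eq_deriv _ h1 h2
  have hspace : ∀ i, ∀ x ∈ Metric.ball x₀ (1 + M * T),
      fderivWithin ℝ U (slab (Space n) T) (x, 0) (EuclideanSpace.single i 1, 0) = 0 := by
    intro i x hx
    have h1 : HasFDerivWithinAt (fun y => U (y, (0 : ℝ))) _ univ x :=
      (hD x).comp x (hasFDerivAt_prodMk_left x (0 : ℝ)).hasFDerivWithinAt
        fun y _ => slab_zero_mem hT y
    have h2 : HasFDerivAt (fun y => U (y, (0 : ℝ))) (0 : Space n →L[ℝ] ℂ) x := by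
      refine (hasFDerivAt_const (0 : ℂ) x).congr_of_eventuallyEq ?_
      filter_upwards [Metric.isOpen_ball.mem_nhds hx] with y hy
      rw [hU.value, h₀ y hy]
    have h3 := (hasFDerivWithinAt_univ.1 h1).unique h2
    simpa using DFunLike.congr_fun h3 (EuclideanSpace.single i 1)
  have key : ∀ L : ℂ →L[ℝ] ℝ, L (U (x₀, t)) = 0 := fun L =>
    (hU.isFirstOrderSolution L).eq_zero hM hA x₀ (fun x hx => by simp [hU.value, h₀ x hx])
      (fun x hx => by simp [hvel x hx]) (fun i x hx => by simp [hspace i x hx]) ht htT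
  exact Complex.ext (key Complex.reCLM) (key Complex.imCLM)

theorem IsWaveOn.eqOn (hU : IsWaveOn A T g₀ g₁ U) (hV : IsWaveOn A T g₀ g₁ V) :
    EqOn U V (slab (Space n) T) := by
  rintro ⟨x, t⟩ ⟨-, h0, hT⟩
  obtain ⟨M, hM, hA⟩ := A.exists_speed
  have h := (hU.add (hV.const_smul (-1))).eq_zero hM hA (x₀ := x) (by simp) (by simp) h0 hT
  simpa [add_neg_eq_zero] using h

end Wave

section Time

variable {F : Type*} [NormedAddCommGroup F] [NormedSpace ℝ F]

theorem hasDerivWithinAt_rpow_smul_log {g : ℝ → F} {g' : F} {s r : Set ℝ} {τ : ℝ} (α : ℝ)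
    (hτ : τ < 1) (hg : HasDerivWithinAt g g' r (-Real.log (1 - τ)))
    (hs : MapsTo (fun σ => -Real.log (1 - σ)) s r) :
    HasDerivWithinAt (fun σ => (1 - σ) ^ α • g (-Real.log (1 - σ)))
      ((1 - τ) ^ (α - 1) • (g' - α • g (-Real.log (1 - τ)))) s τ := by
  have h0 : 1 - τ ≠ 0 := (sub_pos.2 hτ).ne'
  have h1 : HasDerivAt (fun σ : ℝ => 1 - σ) (-1) τ := (hasDerivAt_id τ).const_sub 1
  have h2 := h1.rpow_const (p := α) (Or.inl h0)
  have h3 : HasDerivAt (fun σ : ℝ => -Real.log (1 - σ)) _ τ := (h1.log h0).neg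
  have h4 := h2.hasDerivWithinAt.fun_smul (hg.scomp τ h3.hasDerivWithinAt hs)
  refine h4.congr_deriv ?_
  have h5 : (1 - τ) ^ α = (1 - τ) ^ (α - 1) * (1 - τ) := by
    rw [Real.rpow_sub_one h0]; field_simp
  rw [h5, smul_smul, smul_sub, smul_smul]
  simp only [Function.comp_apply, sub_eq_add_neg, ← neg_smul]
  congr 2
  · rw [← sub_eq_add_neg]; field_simp
  · ring

theorem hasDerivAt_rpow_smul_log {g : ℝ → F} {g' : F} {τ : ℝ} (α : ℝ) (hτ : τ < 1)
    (hg : HasDerivAt g g' (-Real.log (1 - τ))) :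
    HasDerivAt (fun σ => (1 - σ) ^ α • g (-Real.log (1 - σ)))
      ((1 - τ) ^ (α - 1) • (g' - α • g (-Real.log (1 - τ)))) τ := by
  rw [← hasDerivWithinAt_univ] at hg ⊢
  exact hasDerivWithinAt_rpow_smul_log α hτ hg (mapsTo_univ _ _)

theorem neg_log_one_sub_pos {τ : ℝ} (h0 : 0 < τ) (h1 : τ < 1) : 0 < -Real.log (1 - τ) :=
  neg_pos.2 (Real.log_neg (sub_pos.2 h1) (by linarith))

theorem neg_log_one_sub_nonneg {τ : ℝ} (h0 : 0 ≤ τ) (h1 : τ < 1) : 0 ≤ -Real.log (1 - τ) :=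
  neg_nonneg.2 (Real.log_nonpos (sub_pos.2 h1).le (by linarith))

/-- The second derivative after the change of time `t = -log (1 - τ)`. -/
theorem iteratedDeriv_two_rpow_smul_log {g : ℝ → F} {τ : ℝ} (κ : ℝ) (h0 : 0 < τ) (h1 : τ < 1)
    (hg : ContDiffOn ℝ 2 g (Ioi 0)) :
    iteratedDeriv 2 (fun σ => (1 - σ) ^ (-κ) • g (-Real.log (1 - σ))) τ =
      (1 - τ) ^ (-κ - 2) • (iteratedDeriv 2 g (-Real.log (1 - τ))
        + (2 * κ + 1) • deriv g (-Real.log (1 - τ)) + (κ * (κ + 1)) • g (-Real.log (1 - τ))) := by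
  have hd1 : ∀ s : ℝ, 0 < s → HasDerivAt g (deriv g s) s := fun s hs =>
    ((hg.differentiableOn two_ne_zero).differentiableAt (Ioi_mem_nhds hs)).hasDerivAt
  have hd2 : HasDerivAt (deriv g) (iteratedDeriv 2 g (-Real.log (1 - τ))) (-Real.log (1 - τ)) := by
    have h := (hg.deriv_of_isOpen (m := 1) isOpen_Ioi (by norm_num)).differentiableOn one_ne_zero
    rw [iteratedDeriv_succ, iteratedDeriv_one]
    exact (h.differentiableAt (Ioi_mem_nhds (neg_log_one_sub_pos h0 h1))).hasDerivAt
  have hev : deriv (fun σ => (1 - σ) ^ (-κ) • g (-Real.log (1 - σ))) =ᶠ[𝓝 τ]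
      fun σ => (1 - σ) ^ (-κ - 1) • (fun s => deriv g s + κ • g s) (-Real.log (1 - σ)) := by
    filter_upwards [Ioo_mem_nhds h0 h1] with σ hσ
    rw [(hasDerivAt_rpow_smul_log (-κ) hσ.2 (hd1 _ (neg_log_one_sub_pos hσ.1 hσ.2))).deriv]
    simp
  have h2 := hasDerivAt_rpow_smul_log (-κ - 1) h1
    (hd2.fun_add ((hd1 _ (neg_log_one_sub_pos h0 h1)).fun_const_smul κ))
  rw [iteratedDeriv_succ, iteratedDeriv_one, hev.deriv_eq, h2.deriv, sub_sub, one_add_one_eq_two]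
  congr 1
  module

end Time

theorem EllipticOperator.apply_const_smul (A : EllipticOperator n) (r : ℝ) (f : Space n → ℂ)
    (x : Space n) : A.apply (r • f) x = r • A.apply f x := by
  have h : ∀ i (g : Space n → ℂ), partialDeriv i (r • g) = r • partialDeriv i g := by
    intro i g
    funext y
    simp only [partialDeriv, fderiv_const_smul_field, Pi.smul_apply, smul_apply]
  simp only [EllipticOperator.apply, h, Pi.smul_apply, Complex.real_smul, mul_add, Finset.mul_sum,
    mul_left_comm (r : ℂ)]

/-- The change of unknown and of time turning the Klein-Gordon equation into the wave equation. -/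
noncomputable def conformalTransform (κ : ℝ) (ψ : Space n → ℝ → ℂ) (p : Space n × ℝ) : ℂ :=
  (1 - p.2) ^ (-κ) • ψ p.1 (-Real.log (1 - p.2))

theorem IsKleinGordonSolution.isWaveOn {A : EllipticOperator n} {m : ℝ}
    {φ₀ φ₁ : Space n → ℂ} {ψ : Space n → ℝ → ℂ} (hψ : IsKleinGordonSolution A m φ₀ φ₁ ψ)
    {κ : ℝ} (hκ : 2 * κ + 1 = n) (hm : m ^ 2 = κ * (κ + 1)) :
    IsWaveOn A 1 φ₀ (φ₁ + κ • φ₀) (conformalTransform κ ψ) := by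
  have hmaps : MapsTo (fun p : Space n × ℝ => (p.1, -Real.log (1 - p.2))) (slab (Space n) 1)
      (univ ×ˢ Ici 0) := fun p hp => ⟨mem_univ _, neg_log_one_sub_nonneg hp.2.1 hp.2.2⟩
  have hne : ∀ p ∈ slab (Space n) 1, 1 - p.2 ≠ 0 := fun p hp => (sub_pos.2 hp.2.2).ne'
  have hc : ContDiffOn ℝ 2 (fun p : Space n × ℝ => 1 - p.2) (slab (Space n) 1) := by fun_prop
  refine IsWaveOn.of_slices ?_ ?_ ?_ ?_
  · refine (hc.rpow_const_of_ne hne).smul (hψ.contDiffOn.comp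
      (contDiffOn_fst.prodMk (hc.log hne).neg) hmaps)
  · intro x t h0 h1
    have hslice : ContDiffOn ℝ 2 (ψ x) (Ioi 0) := by
      have h : ContDiffOn ℝ 2 (fun s : ℝ => (x, s)) (Ioi 0) := by fun_prop
      exact hψ.contDiffOn.comp h fun s hs => ⟨mem_univ _, (le_of_lt hs : (0 : ℝ) ≤ s)⟩
    have hpos : 0 < 1 - t := sub_pos.2 h1
    have e1 := iteratedDeriv_two_rpow_smul_log κ h0 h1 hslice
    have e2 := hψ.equation x _ (neg_log_one_sub_pos h0 h1)
    have e3 : A.apply (fun y => conformalTransform κ ψ (y, t)) x =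
        (1 - t) ^ (-κ) • A.apply (fun y => ψ y (-Real.log (1 - t))) x :=
      A.apply_const_smul ((1 - t) ^ (-κ)) (fun y => ψ y (-Real.log (1 - t))) x
    have e4 : Real.exp (-2 * -Real.log (1 - t)) = (1 - t) ^ 2 := by
      rw [show -2 * -Real.log (1 - t) = Real.log (1 - t) + Real.log (1 - t) by ring, Real.exp_add,
        Real.exp_log hpos, sq]
    have e5 : (1 - t) ^ (-κ) = (1 - t) ^ (-κ - 2) * (1 - t) ^ 2 := by
      rw [← Real.rpow_natCast, ← Real.rpow_add hpos]; congr 1; push_cast; ring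
    rw [e3]
    refine e1.trans ?_
    rw [hκ, ← hm, e5, mul_smul]
    congr 1
    rw [e4] at e2
    simp only [Complex.real_smul]
    push_cast at e2 ⊢
    linear_combination e2
  · intro x
    simp [conformalTransform, hψ.initial_value]
  · intro x
    have hd : HasDerivWithinAt (ψ x) (φ₁ x) (Ici 0) (-Real.log (1 - 0)) := by
      rw [← hψ.initial_velocity x]
      have h := (hψ.contDiffOn.differentiableOn two_ne_zero) (x, 0) ⟨mem_univ _, self_mem_Ici⟩
      have h' : DifferentiableWithinAt ℝ (ψ x) (Ici 0) 0 := h.comp (0 : ℝ)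
        (by fun_prop : DifferentiableWithinAt ℝ (fun s : ℝ => (x, s)) (Ici 0) 0)
        fun s hs => ⟨mem_univ _, hs⟩
      simpa using h'.hasDerivWithinAt
    have h1 := hasDerivWithinAt_rpow_smul_log (-κ) one_pos hd (s := Ico 0 1)
      fun σ hσ => neg_log_one_sub_nonneg hσ.1 hσ.2
    have h2 := h1.mono_of_mem_nhdsWithin (Ico_mem_nhdsGE one_pos)
    simpa [conformalTransform, hψ.initial_value] using h2

section Taylor

variable {u : Space n → ℝ → ℂ}

theorem contDiffOn_iteratedDeriv_time
    (hu : ContDiffOn ℝ ∞ (fun p : Space n × ℝ => u p.1 p.2) (univ ×ˢ Ioi 0)) (k : ℕ) :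
    ContDiffOn ℝ ∞ (fun p : Space n × ℝ => iteratedDeriv k (u p.1) p.2) (univ ×ˢ Ioi 0) := by
  have ho : IsOpen (univ ×ˢ Ioi 0 : Set (Space n × ℝ)) := isOpen_univ.prod isOpen_Ioi
  induction k with
  | zero => simpa using hu
  | succ k ih =>
    refine ((ih.fderiv_of_isOpen (m := ∞) ho (by simp)).clm_apply
      (contDiffOn_const (c := ((0, 1) : Space n × ℝ)))).congr ?_
    rintro ⟨x, t⟩ hp
    rw [iteratedDeriv_succ]
    exact (hasDerivAt_slice_time (G := fun p => iteratedDeriv k (u p.1) p.2)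
      ((ih.differentiableOn (by simp)).differentiableAt (ho.mem_nhds hp))).deriv

theorem contDiffAt_time (hu : ContDiffOn ℝ ∞ (fun p : Space n × ℝ => u p.1 p.2) (univ ×ˢ Ioi 0))
    (x : Space n) {t : ℝ} (ht : 0 < t) : ContDiffAt ℝ ∞ (u x) t := by
  have h1 : ContDiffAt ℝ ∞ (fun p : Space n × ℝ => u p.1 p.2) (x, t) :=
    hu.contDiffAt ((isOpen_univ.prod isOpen_Ioi).mem_nhds ⟨mem_univ _, ht⟩)
  exact h1.comp t (by fun_prop : ContDiffAt ℝ ∞ (fun s : ℝ => (x, s)) t)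

/-- Taylor's formula at time `1`, uniform in space for functions with bounded support. -/
theorem exists_taylor_bound
    (hu : ContDiffOn ℝ ∞ (fun p : Space n × ℝ => u p.1 p.2) (univ ×ˢ Ioi 0)) {R : ℝ}
    (hR : ∀ x : Space n, R < ‖x‖ → ∀ t : ℝ, 0 < t → t < 2 → u x t = 0) {N : ℕ} (hN : 1 ≤ N) :
    ∃ C : ℝ, ∀ x : Space n, ∀ z : ℝ, 0 ≤ z → z ≤ 1 / 2 →
      ‖u x (1 - z) - ∑ k ∈ Finset.range N, taylorCoeff u k x * (z : ℂ) ^ k‖ ≤ C * z ^ N := by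
  obtain ⟨m, rfl⟩ : ∃ m, N = m + 1 := ⟨N - 1, by omega⟩
  have hK : IsCompact (Metric.closedBall (0 : Space n) R ×ˢ Icc (1 / 2 : ℝ) 1) :=
    (isCompact_closedBall _ _).prod isCompact_Icc
  obtain ⟨C, hC⟩ := hK.exists_bound_of_continuousOn
    ((contDiffOn_iteratedDeriv_time hu (m + 1)).continuousOn.mono
      (prod_mono (subset_univ _) fun t (ht : t ∈ Icc (1 / 2 : ℝ) 1) =>
        (by norm_num : (0 : ℝ) < 1 / 2).trans_le ht.1))
  have hbound : ∀ x : Space n, ∀ t ∈ Icc (1 / 2 : ℝ) 1, ‖iteratedDeriv (m + 1) (u x) t‖ ≤ |C| := by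
    intro x t ht
    by_cases hx : ‖x‖ ≤ R
    · exact (hC (x, t) ⟨by simpa using hx, ht⟩).trans (le_abs_self C)
    · have hev : u x =ᶠ[𝓝 t] fun _ => 0 := by
        filter_upwards [Ioo_mem_nhds (a := 0) (b := 2) (by linarith [ht.1]) (by linarith [ht.2])]
          with s hs
        exact hR x (not_le.1 hx) s hs.1 hs.2
      rw [hev.iteratedDeriv_eq]
      simp
  refine ⟨|C| / m.factorial, fun x z hz0 hz => ?_⟩
  have hf : ∀ s ∈ Icc (0 : ℝ) (1 / 2), ContDiffAt ℝ ∞ (fun s => u x (1 - s)) s := fun s hs =>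
    (contDiffAt_time hu x (by linarith [hs.2] : 0 < 1 - s)).comp s (by fun_prop)
  have hw : ∀ k : ℕ, ∀ s ∈ Icc (0 : ℝ) (1 / 2),
      iteratedDerivWithin k (fun s => u x (1 - s)) (Icc 0 (1 / 2)) s =
        (-1) ^ k * iteratedDeriv k (u x) (1 - s) := by
    intro k s hs
    rw [iteratedDerivWithin_eq_iteratedDeriv (uniqueDiffOn_Icc (by norm_num))
      (contDiffAt_infty.1 (hf s hs) k) hs, iteratedDeriv_comp_const_sub]
    simp
  have hT := taylor_mean_remainder_bound (f := fun s => u x (1 - s)) (n := m) (C := |C|)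
    (by norm_num : (0 : ℝ) ≤ 1 / 2)
    (fun s hs => (contDiffAt_infty.1 (hf s hs) (m + 1)).contDiffWithinAt) ⟨hz0, hz⟩
    (fun s hs => by
      rw [hw _ s hs, norm_mul, norm_pow, norm_neg, norm_one, one_pow, one_mul]
      exact hbound x _ ⟨by linarith [hs.2], by linarith [hs.1]⟩)
  rw [taylor_within_apply] at hT
  have hsum : ∑ k ∈ Finset.range (m + 1), (((k.factorial : ℝ))⁻¹ * (z - 0) ^ k) •
      iteratedDerivWithin k (fun s => u x (1 - s)) (Icc 0 (1 / 2)) 0 =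
      ∑ k ∈ Finset.range (m + 1), taylorCoeff u k x * (z : ℂ) ^ k := by
    refine Finset.sum_congr rfl fun k _ => ?_
    rw [hw k 0 ⟨le_rfl, by norm_num⟩, Complex.real_smul, taylorCoeff]
    push_cast
    simp only [sub_zero]
    ring
  rw [hsum, sub_zero] at hT
  exact hT.trans_eq (by ring)

end Taylor

/-- The superposition of wave solutions that corresponds to the Klein-Gordon solution. -/
noncomputable def superposition (κ : ℝ) (v₀ V₀ V₁ : Space n → ℝ → ℂ) (x : Space n) (t : ℝ) : ℂ :=
  v₀ x t + κ * V₀ x t + V₁ x t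

section Superposition

variable {A : EllipticOperator n} {φ₀ φ₁ : Space n → ℂ} {v₀ V₀ V₁ : Space n → ℝ → ℂ}

theorem IsWaveSolution.contDiffOn_pos {g₀ g₁ : Space n → ℂ} {u : Space n → ℝ → ℂ}
    (hu : IsWaveSolution A g₀ g₁ u) :
    ContDiffOn ℝ ∞ (fun p : Space n × ℝ => u p.1 p.2) (univ ×ˢ Ioi 0) :=
  hu.smooth.mono (prod_mono_right Ioi_subset_Ici_self)

theorem isWaveOn_superposition (κ : ℝ) (hv₀ : IsWaveSolution A φ₀ 0 v₀)
    (hV₀ : IsWaveSolution A 0 φ₀ V₀) (hV₁ : IsWaveSolution A 0 φ₁ V₁) (T : ℝ) :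
    IsWaveOn A T φ₀ (φ₁ + κ • φ₀) fun p => superposition κ v₀ V₀ V₁ p.1 p.2 := by
  have h := ((hv₀.isWaveOn T).add ((hV₀.isWaveOn T).const_smul (κ : ℂ))).add (hV₁.isWaveOn T)
  have e1 : φ₀ + (κ : ℂ) • (0 : Space n → ℂ) + 0 = φ₀ := by simp
  have e2 : 0 + (κ : ℂ) • φ₀ + φ₁ = φ₁ + κ • φ₀ := by
    funext x; simp [add_comm]
  rw [e1, e2] at h
  exact h

theorem contDiffOn_superposition (κ : ℝ) (hv₀ : IsWaveSolution A φ₀ 0 v₀)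
    (hV₀ : IsWaveSolution A 0 φ₀ V₀) (hV₁ : IsWaveSolution A 0 φ₁ V₁) :
    ContDiffOn ℝ ∞ (fun p : Space n × ℝ => superposition κ v₀ V₀ V₁ p.1 p.2) (univ ×ˢ Ioi 0) :=
  (hv₀.contDiffOn_pos.add (contDiffOn_const.mul hV₀.contDiffOn_pos)).add hV₁.contDiffOn_pos

theorem taylorCoeff_superposition (κ : ℝ) (hv₀ : IsWaveSolution A φ₀ 0 v₀)
    (hV₀ : IsWaveSolution A 0 φ₀ V₀) (hV₁ : IsWaveSolution A 0 φ₁ V₁) (k : ℕ) (x : Space n) :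
    taylorCoeff (superposition κ v₀ V₀ V₁) k x =
      taylorCoeff v₀ k x + κ * taylorCoeff V₀ k x + taylorCoeff V₁ k x := by
  have h0 := contDiffAt_infty.1 (contDiffAt_time hv₀.contDiffOn_pos x one_pos) k
  have h1 := contDiffAt_infty.1 (contDiffAt_time hV₀.contDiffOn_pos x one_pos) k
  have h2 := contDiffAt_infty.1 (contDiffAt_time hV₁.contDiffOn_pos x one_pos) k
  have h3 : ContDiffAt ℝ k (fun t => (κ : ℂ) * V₀ x t) 1 := contDiffAt_const.mul h1
  simp only [taylorCoeff, superposition]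
  rw [iteratedDeriv_fun_add (h0.add h3) h2, iteratedDeriv_fun_add h0 h3,
    iteratedDeriv_const_mul_field]
  ring

theorem psiAsympt_eq {κ : ℝ} (hκ : 2 * κ + 1 = n) (hv₀ : IsWaveSolution A φ₀ 0 v₀)
    (hV₀ : IsWaveSolution A 0 φ₀ V₀) (hV₁ : IsWaveSolution A 0 φ₁ V₁) (N : ℕ) (x : Space n)
    {z : ℝ} (hz : 0 ≤ z) :
    psiAsympt v₀ V₀ V₁ N x (z : ℂ) = ((z ^ κ : ℝ) : ℂ) *
      ∑ k ∈ Finset.range N, taylorCoeff (superposition κ v₀ V₀ V₁) k x * (z : ℂ) ^ k := by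
  have e : ((n : ℂ) - 1) / 2 = (κ : ℂ) := by
    have : ((2 * κ + 1 : ℝ) : ℂ) = ((n : ℝ) : ℂ) := by rw [hκ]
    push_cast at this
    rw [← this]; ring
  simp only [psiAsympt, e, taylorCoeff_superposition κ hv₀ hV₀ hV₁, Complex.ofReal_cpow hz, add_mul,
    Finset.sum_add_distrib, Finset.mul_sum, mul_add]
  simp only [mul_assoc]

theorem IsKleinGordonSolution.eq_superposition {m κ : ℝ} {ψ : Space n → ℝ → ℂ}
    (hψ : IsKleinGordonSolution A m φ₀ φ₁ ψ) (hκ : 2 * κ + 1 = n) (hm : m ^ 2 = κ * (κ + 1))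
    (hv₀ : IsWaveSolution A φ₀ 0 v₀)
    (hV₀ : IsWaveSolution A 0 φ₀ V₀) (hV₁ : IsWaveSolution A 0 φ₁ V₁) (x : Space n) {t : ℝ}
    (ht : 0 ≤ t) : ψ x t = ((Real.exp (-t) ^ κ : ℝ) : ℂ) *
      superposition κ v₀ V₀ V₁ x (1 - Real.exp (-t)) := by
  have hlt := Real.exp_pos (-t)
  have hle : Real.exp (-t) ≤ 1 := Real.exp_le_one_iff.2 (by linarith)
  have h := (hψ.isWaveOn hκ hm).eqOn (isWaveOn_superposition κ hv₀ hV₀ hV₁ 1)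
    (show (x, 1 - Real.exp (-t)) ∈ slab (Space n) 1 from
      ⟨mem_univ _, by simpa using ht, by simpa using hlt⟩)
  simp only [conformalTransform, sub_sub_cancel, Real.log_exp, neg_neg] at h
  rw [← h, Complex.real_smul, ← mul_assoc, ← Complex.ofReal_mul, ← Real.rpow_add hlt]
  simp

/-- Solutions of the wave equation with compactly supported data have bounded support. -/
theorem IsWaveOn.exists_support_bound {g₀ g₁ : Space n → ℂ} {T : ℝ} {U : Space n × ℝ → ℂ}
    (hU : IsWaveOn A T g₀ g₁ U) (h₀ : HasCompactSupport g₀) (h₁ : HasCompactSupport g₁) :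
    ∃ R : ℝ, ∀ x : Space n, R < ‖x‖ → ∀ t : ℝ, 0 < t → t < T → U (x, t) = 0 := by
  obtain ⟨M, hM, hA⟩ := A.exists_speed
  obtain ⟨r, hr⟩ := (h₀.isCompact.union h₁.isCompact).isBounded.subset_closedBall (0 : Space n)
  refine ⟨r + (1 + M * T), fun x hx t h0 hT => ?_⟩
  have hout : ∀ y ∈ Metric.ball x (1 + M * T), y ∉ tsupport g₀ ∪ tsupport g₁ := by
    intro y hy hys
    have h1 : ‖y‖ ≤ r := by simpa using hr hys
    have h2 : ‖x - y‖ < 1 + M * T := by simpa [dist_eq_norm, norm_sub_rev] using hy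
    have h3 : ‖x‖ ≤ ‖x - y‖ + ‖y‖ := by simpa using norm_add_le (x - y) y
    linarith
  exact hU.eq_zero hM hA
    (fun y hy => image_eq_zero_of_notMem_tsupport fun h => hout y hy (Or.inl h))
    (fun y hy => image_eq_zero_of_notMem_tsupport fun h => hout y hy (Or.inr h)) h0.le hT

end Superposition

end DeSitter

open DeSitter

theorem mainTheorem10 (n : ℕ) (hn : 1 ≤ n) (A : DeSitter.EllipticOperator n)
    (m : ℝ) (hm : m = Real.sqrt ((n : ℝ) ^ 2 - 1) / 2)
    (φ₀ φ₁ : DeSitter.Space n → ℂ)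
    (hφ₀ : DeSitter.IsTestFunction φ₀) (hφ₁ : DeSitter.IsTestFunction φ₁)
    (N : ℕ) (hN : 1 ≤ N) :
    ∃ C T : ℝ, ∀ v₀ V₀ V₁ ψ : DeSitter.Space n → ℝ → ℂ,
      DeSitter.IsWaveSolution A φ₀ 0 v₀ →
      DeSitter.IsWaveSolution A 0 φ₀ V₀ →
      DeSitter.IsWaveSolution A 0 φ₁ V₁ →
      DeSitter.IsKleinGordonSolution A m φ₀ φ₁ ψ →
      ∀ t : ℝ, T ≤ t →
        MeasureTheory.eLpNorm
            (fun x => ψ x t - DeSitter.psiAsympt v₀ V₀ V₁ N x (Real.exp (-t) : ℂ))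
            ⊤ MeasureTheory.volume
          ≤ ENNReal.ofReal (C * Real.exp (-(N : ℝ) * t - ((n : ℝ) - 1) / 2 * t)) := by
  set κ : ℝ := ((n : ℝ) - 1) / 2 with hκdef
  have hκ : 2 * κ + 1 = n := by rw [hκdef]; ring
  have hn1 : (1 : ℝ) ≤ n := by exact_mod_cast hn
  have hm2 : m ^ 2 = κ * (κ + 1) := by
    rw [hm, div_pow, Real.sq_sqrt (by nlinarith), hκdef]; ring
  by_cases hex : ∃ w₀ W₀ W₁ : Space n → ℝ → ℂ,
      IsWaveSolution A φ₀ 0 w₀ ∧ IsWaveSolution A 0 φ₀ W₀ ∧ IsWaveSolution A 0 φ₁ W₁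
  swap
  · exact ⟨0, 0, fun v₀ V₀ V₁ _ h0 h1 h2 => absurd ⟨v₀, V₀, V₁, h0, h1, h2⟩ hex⟩
  obtain ⟨w₀, W₀, W₁, hw₀, hW₀, hW₁⟩ := hex
  have hw := isWaveOn_superposition κ hw₀ hW₀ hW₁ 2
  obtain ⟨R, hR⟩ := hw.exists_support_bound hφ₀.2
    (hφ₁.2.add (hφ₀.2.smul_left (f := fun _ => κ)))
  obtain ⟨C, hC⟩ := exists_taylor_bound (contDiffOn_superposition κ hw₀ hW₀ hW₁) hR hN
  refine ⟨C, Real.log 2, fun v₀ V₀ V₁ ψ hv₀ hV₀ hV₁ hψ t ht => ?_⟩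
  have ht0 : 0 ≤ t := (Real.log_nonneg one_le_two).trans ht
  set z := Real.exp (-t) with hz
  have hzpos : 0 < z := Real.exp_pos _
  have hz2 : z ≤ 1 / 2 := by
    rw [hz, one_div, ← Real.exp_log two_pos, ← Real.exp_neg]
    exact Real.exp_le_exp.2 (neg_le_neg (by simpa using ht))
  have hcoeff : ∀ k x, taylorCoeff (superposition κ v₀ V₀ V₁) k x =
      taylorCoeff (superposition κ w₀ W₀ W₁) k x := by
    intro k x
    have hev : superposition κ v₀ V₀ V₁ x =ᶠ[nhds 1] superposition κ w₀ W₀ W₁ x := by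
      filter_upwards [Ioo_mem_nhds (zero_lt_one' ℝ) one_lt_two] with s hs
      exact (isWaveOn_superposition κ hv₀ hV₀ hV₁ 2).eqOn hw
        (show (x, s) ∈ slab (Space n) 2 from ⟨Set.mem_univ _, hs.1.le, hs.2⟩)
    simp only [taylorCoeff]
    rw [hev.iteratedDeriv_eq]
  rw [MeasureTheory.eLpNorm_exponent_top]
  refine MeasureTheory.eLpNormEssSup_le_of_ae_bound (Filter.Eventually.of_forall fun x => ?_)
  rw [psiAsympt_eq hκ hv₀ hV₀ hV₁ N x hzpos.le, hψ.eq_superposition hκ hm2 hw₀ hW₀ hW₁ x ht0]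
  simp only [hcoeff]
  rw [← mul_sub, norm_mul, Complex.norm_real, Real.norm_of_nonneg (Real.rpow_nonneg hzpos.le κ)]
  calc z ^ κ * _ ≤ z ^ κ * (C * z ^ N) :=
        mul_le_mul_of_nonneg_left (hC x z hzpos.le hz2) (Real.rpow_nonneg hzpos.le κ)
    _ = C * Real.exp (-(N : ℝ) * t - κ * t) := by
        rw [hz, ← Real.exp_mul, ← Real.exp_nat_mul, mul_left_comm, ← Real.exp_add]
        congr 2; ring
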